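/- Let $n\ge 3$ and let $\bar e\in\mathbb S^{n-1}$. Let $L\subset\mathbb R^n$ be a convex body (a non-empty compact convex set) of revolution, that is, $\vartheta L=L$ for every rotation $\vartheta\in SO(n)$ with $\vartheta\bar e=\bar e$, and suppose that $L$ is not a single point. Let $h_L(u)=\max_{x\in L}\langle x,u\rangle$, $u\in\mathbb S^{n-1}$, be its support function, let $\square_n=\frac1{n-1}\Delta_{\mathbb S}+\mathrm{Id}$, where $\Delta_{\mathbb S}$ is the spherical Laplacian (applied to $h_L$ in the sense of distributions), and for a distribution $\nu$ on $\mathbb S^{n-1}$ let $a^n_k[\nu]=\langle P^n_k(\langle\bar e,\cdot\rangle),\nu\rangle$, where $P^n_k$ is the Legendre polynomial of dimension $n$ and degree $k$, normalized by $P^n_k(1)=1$; thus $$a^n_k[\square_n h_L]=\int_{\mathbb S^{n-1}}h_L(u)\,\square_n\big(P^n_k(\langle\bar e,\cdot\rangle)\big)(u)\,du .$$ Then $a^n_0[\square_n h_L]>0$ and $$-\frac1{n-1}\le\frac{a^n_2[\square_n h_L]}{a^n_0[\square_n h_L]}\le\frac1{(n-1)^2}.$$ Equality holds in the left hand inequality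 if and only if $L$ is a line segment, and in the right hand inequality if and only if $L$ is an $(n-1)$-dimensional disk (a closed ball of positive radius in a hyperplane). -/

import Mathlib

open scoped Manifold ContDiff InnerProductSpace

noncomputable section

namespace ConvexRevolution

/-- Euclidean space `ℝⁿ`. -/
abbrev E (n : ℕ) : Type := EuclideanSpace ℝ (Fin n)

/-- The unit sphere `S^{n-1}` of `ℝⁿ`. -/
abbrev S (n : ℕ) : Type := Metric.sphere (0 : E n) 1

/-- The dimension of `ℝⁿ` in the form in which the manifold structure of the sphere needs it. -/
instance factFinrank (n : ℕ) [NeZero n] : Fact (Module.finrank ℝ (E n) = (n - 1) + 1) :=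
  ⟨by rw [finrank_euclideanSpace_fin]; have := NeZero.pos n; omega⟩

/-- The space `C^∞(S^{n-1})` of smooth functions (test functions) on the sphere. -/
abbrev Test (n : ℕ) [NeZero n] : Type := C^∞⟮𝓡 (n - 1), S n; ℝ⟯

/-- The `0`-homogeneous extension `x ↦ φ(x/|x|)` of a function on the sphere
(with the irrelevant value `0` at the origin). -/
def homExt {n : ℕ} (φ : S n → ℝ) (x : E n) : ℝ :=
  open Classical in
  if hx : x ≠ 0 then φ ⟨‖x‖⁻¹ • x, by simp [norm_smul, hx]⟩ else 0

/-- The Laplace–Beltrami operator of the sphere: the value at `u` of the Laplacian in `ℝⁿ` of the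
`0`-homogeneous extension. -/
def sphLaplacian {n : ℕ} (φ : S n → ℝ) (u : S n) : ℝ :=
  Laplacian.laplacian (homExt φ) (u : E n)

theorem contDiffAt_homExt {n : ℕ} [NeZero n] (φ : Test n) {x : E n} (hx : x ≠ 0) :
    ContDiffAt ℝ ∞ (homExt φ) x := by
  let U : TopologicalSpace.Opens (E n) := ⟨{0}ᶜ, isOpen_compl_singleton⟩
  have hU : ∀ y : U, (y : E n) ≠ 0 := fun y => y.2
  have h1 : ContMDiff (𝓘(ℝ, E n)) (𝓘(ℝ, E n)) ∞ (fun y : U => ‖(y : E n)‖⁻¹ • (y : E n)) := by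
    intro y
    have h : ContMDiffAt (𝓘(ℝ, E n)) (𝓘(ℝ, E n)) ∞ (fun y : E n => ‖y‖⁻¹ • y) (y : E n) := by
      rw [contMDiffAt_iff_contDiffAt]
      exact ((contDiffAt_norm ℝ (hU y)).inv (norm_ne_zero_iff.2 (hU y))).smul contDiffAt_id
    exact contMDiffAt_subtype_iff.2 h
  have h2 : ∀ y : U, ‖(y : E n)‖⁻¹ • (y : E n) ∈ Metric.sphere (0 : E n) 1 := by
    intro y; simp [norm_smul, hU y]
  have h3 := φ.contMDiff.comp (h1.codRestrict_sphere h2)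
  have h4 := h3 ⟨x, hx⟩
  rw [← contMDiffAt_iff_contDiffAt]
  refine (contMDiffAt_subtype_iff (U := U) (x := ⟨x, hx⟩)).1 (h4.congr_of_eventuallyEq ?_)
  refine Filter.Eventually.of_forall fun y => ?_
  simp [homExt, hU y, Set.codRestrict]

theorem contMDiff_sphLaplacian {n : ℕ} [NeZero n] (φ : Test n) :
    ContMDiff (𝓡 (n - 1)) 𝓘(ℝ, ℝ) ∞ (sphLaplacian φ) := by
  have key : ∀ x : E n, x ≠ 0 → ContDiffAt ℝ ∞ (Laplacian.laplacian (homExt φ)) x := by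
    intro x hx
    rw [InnerProductSpace.laplacian_eq_iteratedFDeriv_stdOrthonormalBasis]
    refine ContDiffAt.sum fun i _ => ?_
    have h := (contDiffAt_homExt φ hx).iteratedFDeriv_right (m := ∞) (i := 2) (by rfl)
    exact (ContinuousMultilinearMap.apply ℝ (fun _ : Fin 2 => E n) ℝ _).contDiff.contDiffAt.comp x h
  intro u
  have hu : (u : E n) ≠ 0 := ne_zero_of_mem_unit_sphere u
  exact (key u hu).contMDiffAt.comp u (contMDiff_coe_sphere (n := n - 1) u)

theorem homExt_add {n : ℕ} (φ ψ : S n → ℝ) : homExt (φ + ψ) = homExt φ + homExt ψ := by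
  ext x; by_cases hx : x = 0 <;> simp [homExt, hx]

theorem homExt_smul {n : ℕ} (c : ℝ) (φ : S n → ℝ) : homExt (c • φ) = c • homExt φ := by
  ext x; by_cases hx : x = 0 <;> simp [homExt, hx]

/-- The Laplace–Beltrami operator as a linear operator on `C^∞(S^{n-1})`. -/
def laplace (n : ℕ) [NeZero n] : Test n →ₗ[ℝ] Test n where
  toFun φ := ⟨sphLaplacian φ, contMDiff_sphLaplacian φ⟩
  map_add' φ ψ := by
    ext u
    have hu : (u : E n) ≠ 0 := ne_zero_of_mem_unit_sphere u
    have h2 : (2 : WithTop ℕ∞) ≤ ∞ := WithTop.coe_le_coe.2 (le_top : (2 : ℕ∞) ≤ ⊤)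
    change sphLaplacian (⇑φ + ⇑ψ) u = sphLaplacian φ u + sphLaplacian ψ u
    rw [sphLaplacian, homExt_add]
    exact ((contDiffAt_homExt φ hu).of_le h2).laplacian_add ((contDiffAt_homExt ψ hu).of_le h2)
  map_smul' c φ := by
    ext u
    have hu : (u : E n) ≠ 0 := ne_zero_of_mem_unit_sphere u
    have h2 : (2 : WithTop ℕ∞) ≤ ∞ := WithTop.coe_le_coe.2 (le_top : (2 : ℕ∞) ≤ ⊤)
    change sphLaplacian (c • ⇑φ) u = c • sphLaplacian φ u
    rw [sphLaplacian, homExt_smul]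
    exact InnerProductSpace.laplacian_smul c ((contDiffAt_homExt φ hu).of_le h2)

/-- The box operator `□ₙ = (n-1)⁻¹ Δ_S + Id` on `C^∞(S^{n-1})`. -/
def box (n : ℕ) [NeZero n] : Test n →ₗ[ℝ] Test n :=
  ((n : ℝ) - 1)⁻¹ • laplace n + LinearMap.id

/-- Linear functionals on `C^∞(S^{n-1})`; these contain the distributions on the sphere. -/
abbrev TestDual (n : ℕ) [NeZero n] : Type := Test n →ₗ[ℝ] ℝ

/-- A continuous function `f` on the sphere, regarded as the distribution `φ ↦ ∫ f φ dσ`, where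
`σ` is the (unnormalized) surface area measure of the sphere. -/
def toDual {n : ℕ} [NeZero n] (f : C(S n, ℝ)) : TestDual n where
  toFun φ := ∫ u : S n, f u * φ u ∂((MeasureTheory.volume : MeasureTheory.Measure (E n)).toSphere)
  map_add' φ ψ := by
    have hi : ∀ χ : Test n, MeasureTheory.Integrable (fun u : S n => f u * χ u)
        ((MeasureTheory.volume : MeasureTheory.Measure (E n)).toSphere) := fun χ =>
      (f.continuous.mul χ.contMDiff.continuous).integrable_of_hasCompactSupport
        (HasCompactSupport.of_compactSpace _)
    rw [← MeasureTheory.integral_add (hi φ) (hi ψ)]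
    refine MeasureTheory.integral_congr_ae (Filter.Eventually.of_forall fun u => ?_)
    exact mul_add _ _ _
  map_smul' c φ := by
    rw [RingHom.id_apply, smul_eq_mul, ← MeasureTheory.integral_const_mul]
    refine MeasureTheory.integral_congr_ae (Filter.Eventually.of_forall fun u => ?_)
    exact mul_left_comm _ _ _

/-- The box operator on distributions, defined by duality: `⟨φ, □ₙν⟩ = ⟨□ₙφ, ν⟩`. -/
def boxDual {n : ℕ} [NeZero n] (ν : TestDual n) : TestDual n := ν.comp (box n)

/-- The Legendre polynomial `P^n_k` of dimension `n` and degree `k` (normalized by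
`P^n_k(1) = 1`), through its three-term recurrence. -/
def legendre (n : ℕ) : ℕ → Polynomial ℝ
  | 0 => 1
  | 1 => Polynomial.X
  | k + 2 => Polynomial.C ((k : ℝ) + n - 1)⁻¹ *
      (Polynomial.C (2 * (k : ℝ) + n) * Polynomial.X * legendre n (k + 1)
        - Polynomial.C ((k : ℝ) + 1) * legendre n k)

/-- The zonal spherical harmonic `u ↦ P^n_k(⟨e, u⟩)`. -/
def zonalLegendre {n : ℕ} [NeZero n] (e : S n) (k : ℕ) : Test n :=
  ⟨fun u => (legendre n k).eval ⟪(e : E n), (u : E n)⟫_ℝ, by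
    have h : ContDiff ℝ ∞ (fun x : E n => (legendre n k).eval ⟪(e : E n), x⟫_ℝ) :=
      ((legendre n k).contDiff_aeval ∞).comp (contDiff_const.inner ℝ contDiff_id)
    exact h.contMDiff.comp (contMDiff_coe_sphere (n := n - 1))⟩

/-- The coefficient `a^n_k[ν] = ⟨P^n_k(⟨e, ·⟩), ν⟩` with respect to the pole `e`. -/
def multiplier {n : ℕ} [NeZero n] (e : S n) (k : ℕ) (ν : TestDual n) : ℝ :=
  ν (zonalLegendre e k)

/-- The support function `h_L(u) = max {⟨x, u⟩ : x ∈ L}` on the sphere. -/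
def supportFn {n : ℕ} (L : ConvexBody (E n)) : C(S n, ℝ) :=
  ⟨fun u => sSup ((fun x : E n => ⟪x, (u : E n)⟫_ℝ) '' (L : Set (E n))),
    L.isCompact.continuous_sSup (f := fun (u : S n) (x : E n) => ⟪x, (u : E n)⟫_ℝ)
      (by
        change Continuous fun p : S n × E n => ⟪p.2, (p.1 : E n)⟫_ℝ
        fun_prop)⟩

/-- `L` is a body of revolution with axis `ℝe`: it is invariant under all rotations in `SO(n)`
that fix `e`. -/
def IsBodyOfRevolution {n : ℕ} (e : S n) (L : ConvexBody (E n)) : Prop :=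
  ∀ θ : E n ≃ₗᵢ[ℝ] E n, LinearMap.det (θ.toLinearEquiv : E n →ₗ[ℝ] E n) = 1 →
    θ (e : E n) = e → θ '' (L : Set (E n)) = L

/-- `A` is a (non-degenerate) line segment. -/
def IsLineSegment {n : ℕ} (A : Set (E n)) : Prop :=
  ∃ x y : E n, x ≠ y ∧ A = segment ℝ x y

/-- `A` is an `(n-1)`-dimensional disk: the closed ball of positive radius `r` and center `c`
within the hyperplane through `c` with unit normal `ν`. -/
def IsDisk {n : ℕ} (A : Set (E n)) : Prop :=
  ∃ (c : E n) (ν : S n) (r : ℝ), 0 < r ∧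
    A = {x : E n | ⟪x - c, (ν : E n)⟫_ℝ = 0 ∧ ‖x - c‖ ≤ r}

end ConvexRevolution

end

noncomputable section

namespace ConvexRevolution

open MeasureTheory Set

/-! Write `t = ⟪e, u⟫` and `s = √(1 - t²)`, the distance of `u` from the axis. Since `P_2` is an
eigenfunction of the spherical Laplacian with eigenvalue `-2n`, moving `□ₙ` onto the test functions
gives `a_0 = ∫ h_L` and `a_2 = -(n+1)/(n-1)² ∫ h_L (n t² - 1)`. The upper bound then becomes `∫ h_L
((n+1) t² - 1) ≥ 0` and the lower bound `∫ h_L (2 - (n+1) t²) ≥ 0`. Both weights are even, so `h_L`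
may be replaced by the width `W(u) = h_L(u) + h_L(-u)`.

The first weight is orthogonal to `s`, the profile of a disk, and the second to `|t|`, the profile
of a segment; both facts are Gaussian integrations by parts along the axis
(`integral_sphere_orthogonal_norm`, `integral_sphere_abs_inner`). By revolution `W` depends only on
`(|t|, s)`; being convex and even in each coordinate, it is monotone in each (`width_mono`). By
homogeneity `W / s` increases with `|t| / s`, and `W / |t|` increases with `s / |t|`. If `C` is the
value of such a quotient where the weight vanishes, then `W - C s`, respectively `W - C |t|`, has
the sign of the weight everywhere, so the integral of the product is nonnegative.

In case of equality this product vanishes identically. Evaluated at `e` it gives `W(e) = 0`, which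
forces a disk; evaluated orthogonally to `e` it gives zero transversal width, which forces a
segment. Conversely, a disk or segment that is of revolution about `e` is aligned with `e`, so its
width is a multiple of the profile. -/

/-- The surface area measure of the sphere. -/
abbrev sphereMeasure (n : ℕ) : Measure (S n) := (volume : Measure (E n)).toSphere

/-! ### Polar coordinates with Gaussian weight -/

/-- The radial moment `∫₀^∞ r^q e^{-r²} dr`. -/
def radialMoment (q : ℕ) : ℝ := ∫ r in Ioi (0 : ℝ), r ^ q * Real.exp (-r ^ 2)

theorem radialMoment_eq (q : ℕ) : radialMoment q = 1 / 2 * Real.Gamma (((q : ℝ) + 1) / 2) := by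
  have h := integral_rpow_mul_exp_neg_rpow (p := 2) (q := q) (by norm_num)
    (by have : (0 : ℝ) ≤ q := by positivity
        linarith)
  rw [← h, radialMoment]
  refine setIntegral_congr_fun measurableSet_Ioi fun r _ => ?_
  simp

theorem radialMoment_pos (q : ℕ) : 0 < radialMoment q := by
  rw [radialMoment_eq]
  have : 0 < Real.Gamma (((q : ℝ) + 1) / 2) := Real.Gamma_pos_of_pos (by positivity)
  positivity

theorem radialMoment_add_two (q : ℕ) :
    radialMoment (q + 2) = ((q : ℝ) + 1) / 2 * radialMoment q := by
  rw [radialMoment_eq, radialMoment_eq]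
  have h : (((q + 2 : ℕ) : ℝ) + 1) / 2 = ((q : ℝ) + 1) / 2 + 1 := by push_cast; ring
  rw [h, Real.Gamma_add_one (by positivity)]
  ring

/-- Polar coordinates for a homogeneous function with Gaussian weight. -/
theorem integral_homogeneous_mul_gaussian {n : ℕ} (hn : 0 < n) (p : ℕ) (F : E n → ℝ) (f : S n → ℝ)
    (hF : ∀ (r : ℝ) (u : S n), 0 < r → F (r • (u : E n)) = r ^ p * f u) :
    ∫ x, F x * Real.exp (-‖x‖ ^ 2) =
      (∫ u, f u ∂(sphereMeasure n)) * radialMoment (n - 1 + p) := by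
  have : Nontrivial (E n) := by
    have : NeZero n := ⟨hn.ne'⟩
    infer_instance
  set G : E n → ℝ := fun x => F x * Real.exp (-‖x‖ ^ 2)
  calc
    ∫ x, G x = ∫ x : ({(0)}ᶜ : Set (E n)), G x.1 ∂(volume.comap Subtype.val) := by
      rw [integral_subtype_comap (measurableSet_singleton _).compl fun x ↦ G x,
        restrict_compl_singleton]
    _ = ∫ x : S n × Ioi (0 : ℝ), f x.1 * ((x.2 : ℝ) ^ p * Real.exp (-(x.2 : ℝ) ^ 2))
          ∂(sphereMeasure n).prod (.volumeIoiPow (n - 1)) := by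
      have := (volume : Measure (E n)).measurePreserving_homeomorphUnitSphereProd.integral_comp
        (Homeomorph.measurableEmbedding _) (fun x : S n × Ioi (0 : ℝ) =>
          f x.1 * ((x.2 : ℝ) ^ p * Real.exp (-(x.2 : ℝ) ^ 2)))
      rw [finrank_euclideanSpace_fin] at this
      rw [← this]
      refine integral_congr_ae (Filter.Eventually.of_forall fun x => ?_)
      have hx : 0 < ‖(x : E n)‖ := norm_pos_iff.2 x.2
      have h := hF ‖(x : E n)‖ (homeomorphUnitSphereProd (E n) x).1 hx
      have h1 : ‖(x : E n)‖ • ((homeomorphUnitSphereProd (E n) x).1 : E n) = x := by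
        simp [smul_smul, hx.ne']
      rw [h1] at h
      simp only [G, h, homeomorphUnitSphereProd_apply_snd_coe]
      ring
    _ = _ := by
      rw [integral_prod_mul (fun u : S n => f u)
        (fun r : Ioi (0 : ℝ) => (r : ℝ) ^ p * Real.exp (-(r : ℝ) ^ 2))]
      congr 1
      simp only [Measure.volumeIoiPow, ENNReal.ofReal]
      rw [integral_withDensity_eq_integral_smul]
      · rw [integral_subtype_comap measurableSet_Ioi fun a : ℝ ↦
            Real.toNNReal (a ^ (n - 1)) • (a ^ p * Real.exp (-a ^ 2)), radialMoment]
        refine setIntegral_congr_fun measurableSet_Ioi fun x hx ↦ ?_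
        rw [NNReal.smul_def, Real.coe_toNNReal _ (pow_nonneg hx.out.le _), smul_eq_mul]
        ring
      · fun_prop

/-- Antipodal invariance is inherited from Lebesgue measure: polar coordinates for the
`0`-homogeneous extensions turn both sides into Gaussian integrals over `ℝⁿ` exchanged by `x ↦ -x`.
-/
theorem integral_comp_neg_sphere {n : ℕ} (hn : 0 < n) (f : S n → ℝ) :
    ∫ u, f (-u) ∂(sphereMeasure n) = ∫ u, f u ∂(sphereMeasure n) := by
  have hext : ∀ g : S n → ℝ, ∀ (r : ℝ) (u : S n), 0 < r →
      homExt g (r • (u : E n)) = r ^ 0 * g u := by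
    intro g r u hr
    have hu : (u : E n) ≠ 0 := ne_zero_of_mem_unit_sphere u
    have hne : r • (u : E n) ≠ 0 := smul_ne_zero hr.ne' hu
    rw [homExt, dif_pos hne, pow_zero, one_mul]
    congr 1
    ext1
    simp [norm_smul, abs_of_pos hr, smul_smul, hr.ne']
  have h1 := integral_homogeneous_mul_gaussian hn 0 (homExt f) f (hext f)
  have h2 := integral_homogeneous_mul_gaussian hn 0 (homExt fun u => f (-u)) _ (hext fun u => f (-u))
  have h3 : ∀ x : E n, homExt (fun u => f (-u)) x = homExt f (-x) := by
    intro x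
    by_cases hx : x = 0
    · simp [homExt, hx]
    · rw [homExt, homExt, dif_pos hx, dif_pos (neg_ne_zero.2 hx)]
      congr 1
      ext1
      simp
  have h4 : ∫ x : E n, homExt (fun u => f (-u)) x * Real.exp (-‖x‖ ^ 2)
      = ∫ x : E n, homExt f x * Real.exp (-‖x‖ ^ 2) := by
    rw [← integral_neg_eq_self]
    simp [h3]
  rw [h1, h2] at h4
  exact mul_right_cancel₀ (radialMoment_pos _).ne' h4

theorem integrable_norm_pow_mul_gaussian {n : ℕ} (hn : 0 < n) (q : ℕ) :
    Integrable fun x : E n => ‖x‖ ^ q * Real.exp (-‖x‖ ^ 2) := by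
  have : Nontrivial (E n) := by
    have : NeZero n := ⟨hn.ne'⟩
    infer_instance
  rw [integrable_fun_norm_addHaar volume (f := fun r : ℝ => r ^ q * Real.exp (-r ^ 2))]
  have h := integrableOn_rpow_mul_exp_neg_mul_sq (b := 1) one_pos
    (s := ((n - 1 + q : ℕ) : ℝ))
    (by have : (0 : ℝ) ≤ ((n - 1 + q : ℕ) : ℝ) := by positivity
        linarith)
  refine h.congr_fun (fun r _ => ?_) measurableSet_Ioi
  simp only [Real.rpow_natCast, finrank_euclideanSpace_fin, smul_eq_mul, pow_add]
  ring_nf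

/-- Only polynomial growth matters; the factor `3` is slack. -/
theorem integrable_mul_gaussian_of_le {n : ℕ} (hn : 0 < n) (q : ℕ) {F : E n → ℝ}
    (hc : Continuous F) (hF : ∀ x, |F x| ≤ 3 * ‖x‖ ^ q) :
    Integrable fun x : E n => F x * Real.exp (-‖x‖ ^ 2) := by
  refine ((integrable_norm_pow_mul_gaussian hn q).const_mul 3).mono'
    (by fun_prop) (Filter.Eventually.of_forall fun x => ?_)
  rw [norm_mul, Real.norm_eq_abs, Real.norm_eq_abs, Real.abs_exp, ← mul_assoc]
  exact mul_le_mul_of_nonneg_right (hF x) (Real.exp_pos _).le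

/-! ### Integration by parts along the axis -/

theorem norm_coe_sphere {n : ℕ} (u : S n) : ‖(u : E n)‖ = 1 := by simp

theorem inner_self_sphere {n : ℕ} (u : S n) : ⟪(u : E n), (u : E n)⟫_ℝ = 1 := by
  rw [real_inner_self_eq_norm_sq, norm_coe_sphere, one_pow]

theorem norm_sub_inner_smul_sq {n : ℕ} (e : S n) (x : E n) :
    ‖x - ⟪(e : E n), x⟫_ℝ • (e : E n)‖ ^ 2 = ‖x‖ ^ 2 - ⟪(e : E n), x⟫_ℝ ^ 2 := by
  rw [norm_sub_sq_real, norm_smul, norm_coe_sphere, inner_smul_right, real_inner_comm x (e : E n),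
    Real.norm_eq_abs, mul_one, sq_abs]
  ring

theorem norm_sub_inner_smul_le {n : ℕ} (e : S n) (x : E n) :
    ‖x - ⟪(e : E n), x⟫_ℝ • (e : E n)‖ ≤ ‖x‖ := by
  refine le_of_sq_le_sq ?_ (norm_nonneg x)
  rw [norm_sub_inner_smul_sq]
  linarith [sq_nonneg ⟪(e : E n), x⟫_ℝ]

theorem abs_inner_le_norm_of_sphere {n : ℕ} (e : S n) (x : E n) : |⟪(e : E n), x⟫_ℝ| ≤ ‖x‖ := by
  simpa [norm_coe_sphere] using abs_real_inner_le_norm (e : E n) x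

theorem hasDerivAt_inner_line {n : ℕ} (e : S n) (x : E n) :
    HasDerivAt (fun t : ℝ => ⟪(e : E n), x + t • (e : E n)⟫_ℝ) 1 0 := by
  have : (fun t : ℝ => ⟪(e : E n), x + t • (e : E n)⟫_ℝ) = fun t => ⟪(e : E n), x⟫_ℝ + t := by
    ext t
    rw [inner_add_right, inner_smul_right, inner_self_sphere, mul_one]
  rw [this]
  exact (hasDerivAt_id (0 : ℝ)).const_add _

theorem hasLineDerivAt_gaussian {n : ℕ} (e : S n) (x : E n) :
    HasLineDerivAt ℝ (fun x : E n => Real.exp (-‖x‖ ^ 2))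
      (-2 * ⟪(e : E n), x⟫_ℝ * Real.exp (-‖x‖ ^ 2)) x (e : E n) := by
  rw [HasLineDerivAt]
  have h1 : (fun t : ℝ => Real.exp (-‖x + t • (e : E n)‖ ^ 2)) =
      fun t : ℝ => Real.exp (-(‖x‖ ^ 2 + 2 * t * ⟪(e : E n), x⟫_ℝ + t ^ 2)) := by
    ext t
    rw [norm_add_sq_real, norm_smul, norm_coe_sphere, inner_smul_right, real_inner_comm,
      Real.norm_eq_abs, mul_one, sq_abs]
    ring_nf
  rw [h1]
  have h2 : HasDerivAt (fun t : ℝ => -(‖x‖ ^ 2 + 2 * t * ⟪(e : E n), x⟫_ℝ + t ^ 2))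
      (-2 * ⟪(e : E n), x⟫_ℝ) 0 := by
    have h := ((((hasDerivAt_id (0 : ℝ)).const_mul 2).mul_const ⟪(e : E n), x⟫_ℝ).const_add
      (‖x‖ ^ 2)).add ((hasDerivAt_id (0 : ℝ)).pow 2) |>.neg
    exact h.congr_deriv (by simp)
  exact h2.exp.congr_deriv (by simp [mul_comm])

/-- The distance to the axis is constant along `e`, while the other factor is the `e`-derivative of
`⟪e, x⟫ exp(-‖x‖²)`; integration by parts leaves nothing. -/
theorem integral_orthogonal_norm_gaussian {n : ℕ} (hn : 0 < n) (e : S n) :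
    ∫ x : E n, ‖x - ⟪(e : E n), x⟫_ℝ • (e : E n)‖ *
      ((1 - 2 * ⟪(e : E n), x⟫_ℝ ^ 2) * Real.exp (-‖x‖ ^ 2)) = 0 := by
  have hline : ∀ x : E n, HasLineDerivAt ℝ
      (fun x : E n => ‖x - ⟪(e : E n), x⟫_ℝ • (e : E n)‖) 0 x (e : E n) := by
    intro x
    rw [HasLineDerivAt]
    have : (fun t : ℝ => ‖x + t • (e : E n) -
        ⟪(e : E n), x + t • (e : E n)⟫_ℝ • (e : E n)‖) =
        fun t => ‖x - ⟪(e : E n), x⟫_ℝ • (e : E n)‖ := by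
      ext t
      rw [inner_add_right, inner_smul_right, inner_self_sphere]
      congr 1
      module
    rw [this]
    exact hasDerivAt_const _ _
  have hg : ∀ x : E n, HasLineDerivAt ℝ
      (fun x : E n => ⟪(e : E n), x⟫_ℝ * Real.exp (-‖x‖ ^ 2))
      ((1 - 2 * ⟪(e : E n), x⟫_ℝ ^ 2) * Real.exp (-‖x‖ ^ 2)) x (e : E n) := by
    intro x
    have h := (hasDerivAt_inner_line e x).mul (hasLineDerivAt_gaussian e x)
    rw [HasLineDerivAt]
    refine h.congr_deriv ?_
    simp only [zero_smul, add_zero]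
    ring
  have h1 : Integrable fun x : E n => ‖x - ⟪(e : E n), x⟫_ℝ • (e : E n)‖ *
      Real.exp (-‖x‖ ^ 2) := by
    refine integrable_mul_gaussian_of_le hn 1 (by fun_prop) fun x => ?_
    rw [abs_of_nonneg (norm_nonneg _)]
    linarith [norm_sub_inner_smul_le e x, norm_nonneg x]
  have h2 : Integrable fun x : E n => (‖x - ⟪(e : E n), x⟫_ℝ • (e : E n)‖ * ⟪(e : E n), x⟫_ℝ) *
      Real.exp (-‖x‖ ^ 2) := by
    refine integrable_mul_gaussian_of_le hn 2 (by fun_prop) fun x => ?_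
    rw [abs_mul, abs_of_nonneg (norm_nonneg _)]
    have := mul_le_mul (norm_sub_inner_smul_le e x) (abs_inner_le_norm_of_sphere e x)
      (abs_nonneg _) (norm_nonneg x)
    nlinarith [sq_nonneg ‖x‖]
  have h3 : Integrable fun x : E n => (‖x - ⟪(e : E n), x⟫_ℝ • (e : E n)‖ *
      ⟪(e : E n), x⟫_ℝ ^ 2) * Real.exp (-‖x‖ ^ 2) := by
    refine integrable_mul_gaussian_of_le hn 3 (by fun_prop) fun x => ?_
    rw [abs_mul, abs_of_nonneg (norm_nonneg _), abs_pow]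
    have := mul_le_mul (norm_sub_inner_smul_le e x)
      (pow_le_pow_left₀ (abs_nonneg _) (abs_inner_le_norm_of_sphere e x) 2)
      (by positivity) (norm_nonneg x)
    nlinarith [pow_nonneg (norm_nonneg x) 3]
  have key := integral_bilinear_hasLineDerivAt_right_eq_neg_left_of_integrable
    (μ := (volume : Measure (E n))) (B := ContinuousLinearMap.mul ℝ ℝ)
    (f := fun x : E n => ‖x - ⟪(e : E n), x⟫_ℝ • (e : E n)‖) (f' := fun _ => 0)
    (g := fun x : E n => ⟪(e : E n), x⟫_ℝ * Real.exp (-‖x‖ ^ 2))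
    (g' := fun x => (1 - 2 * ⟪(e : E n), x⟫_ℝ ^ 2) * Real.exp (-‖x‖ ^ 2)) (v := (e : E n))
    (by simp)
    (by
      refine (h1.sub (h3.const_mul 2)).congr (Filter.Eventually.of_forall fun x => ?_)
      simp only [ContinuousLinearMap.mul_apply', Pi.sub_apply]
      ring)
    (by
      refine h2.congr (Filter.Eventually.of_forall fun x => ?_)
      simp only [ContinuousLinearMap.mul_apply']
      ring)
    (fun x _ => hline x) (fun x _ => hg x)
  simpa using key

/-- Provides an antiderivative of `2|s|` that is differentiable even at the kink, as the integration
by parts below requires. -/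
theorem hasDerivAt_mul_abs (s : ℝ) : HasDerivAt (fun s : ℝ => s * |s|) (2 * |s|) s := by
  rcases lt_trichotomy s 0 with h | rfl | h
  · have h1 := (hasDerivAt_id s).mul (hasDerivAt_abs_neg h)
    refine h1.congr_deriv ?_
    simp [abs_of_neg h]
    ring
  · rw [hasDerivAt_iff_isLittleO_nhds_zero]
    simp only [zero_add, abs_zero, mul_zero, smul_zero, sub_zero]
    rw [Asymptotics.isLittleO_iff]
    intro c hc
    filter_upwards [Metric.ball_mem_nhds (0 : ℝ) hc] with x hx
    rw [Real.norm_eq_abs, Real.norm_eq_abs, abs_mul, abs_abs]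
    rw [Metric.mem_ball, dist_zero_right, Real.norm_eq_abs] at hx
    exact mul_le_mul_of_nonneg_right hx.le (abs_nonneg x)
  · have h1 := (hasDerivAt_id s).mul (hasDerivAt_abs_pos h)
    refine h1.congr_deriv ?_
    simp [abs_of_pos h]
    ring

/-- Integration by parts of `τ|τ|`, `τ = ⟪e, x⟫`, against the Gaussian: one derivative is `2|τ|`,
the other brings down `-2τ`. -/
theorem integral_abs_inner_gaussian {n : ℕ} (hn : 0 < n) (e : S n) :
    ∫ x : E n, |⟪(e : E n), x⟫_ℝ| ^ 3 * Real.exp (-‖x‖ ^ 2) =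
      ∫ x : E n, |⟪(e : E n), x⟫_ℝ| * Real.exp (-‖x‖ ^ 2) := by
  have h1 : Integrable fun x : E n => |⟪(e : E n), x⟫_ℝ| * Real.exp (-‖x‖ ^ 2) := by
    refine integrable_mul_gaussian_of_le hn 1 (by fun_prop) fun x => ?_
    rw [abs_abs]
    linarith [abs_inner_le_norm_of_sphere e x, norm_nonneg x]
  have h2 : Integrable fun x : E n => (⟪(e : E n), x⟫_ℝ * |⟪(e : E n), x⟫_ℝ|) *
      Real.exp (-‖x‖ ^ 2) := by
    refine integrable_mul_gaussian_of_le hn 2 (by fun_prop) fun x => ?_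
    rw [abs_mul, abs_abs, ← pow_two]
    linarith [pow_le_pow_left₀ (abs_nonneg _) (abs_inner_le_norm_of_sphere e x) 2, sq_nonneg ‖x‖]
  have h3 : Integrable fun x : E n => |⟪(e : E n), x⟫_ℝ| ^ 3 * Real.exp (-‖x‖ ^ 2) := by
    refine integrable_mul_gaussian_of_le hn 3 (by fun_prop) fun x => ?_
    rw [abs_pow, abs_abs]
    linarith [pow_le_pow_left₀ (abs_nonneg _) (abs_inner_le_norm_of_sphere e x) 3,
      pow_nonneg (norm_nonneg x) 3]
  have hf : ∀ x : E n, HasLineDerivAt ℝ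
      (fun x : E n => ⟪(e : E n), x⟫_ℝ * |⟪(e : E n), x⟫_ℝ|) (2 * |⟪(e : E n), x⟫_ℝ|) x
      (e : E n) := by
    intro x
    have h0 : HasDerivAt (fun s : ℝ => s * |s|) (2 * |⟪(e : E n), x⟫_ℝ|)
        ⟪(e : E n), x + (0 : ℝ) • (e : E n)⟫_ℝ := by
      simpa using hasDerivAt_mul_abs ⟪(e : E n), x⟫_ℝ
    have h := h0.comp (0 : ℝ) (hasDerivAt_inner_line e x)
    rw [mul_one] at h
    exact h
  have hcube : ∀ s : ℝ, s * |s| * s = |s| ^ 3 := by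
    intro s
    rw [mul_right_comm, ← pow_two, ← sq_abs]
    ring
  have key := integral_bilinear_hasLineDerivAt_right_eq_neg_left_of_integrable
    (μ := (volume : Measure (E n))) (B := ContinuousLinearMap.mul ℝ ℝ)
    (f := fun x : E n => ⟪(e : E n), x⟫_ℝ * |⟪(e : E n), x⟫_ℝ|)
    (f' := fun x => 2 * |⟪(e : E n), x⟫_ℝ|)
    (g := fun x : E n => Real.exp (-‖x‖ ^ 2))
    (g' := fun x => -2 * ⟪(e : E n), x⟫_ℝ * Real.exp (-‖x‖ ^ 2)) (v := (e : E n))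
    (by
      refine (h1.const_mul 2).congr (Filter.Eventually.of_forall fun x => ?_)
      simp only [ContinuousLinearMap.mul_apply']
      ring)
    (by
      refine (h3.const_mul (-2)).congr (Filter.Eventually.of_forall fun x => ?_)
      simp only [ContinuousLinearMap.mul_apply', ← hcube]
      ring)
    h2
    (fun x _ => hf x) (fun x _ => hasLineDerivAt_gaussian e x)
  simp only [ContinuousLinearMap.mul_apply'] at key
  have e1 : ∀ x : E n, ⟪(e : E n), x⟫_ℝ * |⟪(e : E n), x⟫_ℝ| *
      (-2 * ⟪(e : E n), x⟫_ℝ * Real.exp (-‖x‖ ^ 2)) =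
      -2 * (|⟪(e : E n), x⟫_ℝ| ^ 3 * Real.exp (-‖x‖ ^ 2)) := by
    intro x
    rw [← hcube]
    ring
  simp only [e1, mul_assoc (2 : ℝ), integral_const_mul] at key
  linarith

/-- In polar coordinates the degree `3` and degree `1` integrands carry radial moments of orders `n
+ 2` and `n`, whose ratio `(n + 1) / 2` produces the weight. -/
theorem integral_sphere_abs_inner {n : ℕ} (hn : 0 < n) (e : S n) :
    ∫ u : S n, |⟪(e : E n), (u : E n)⟫_ℝ| * (2 - (n + 1) * ⟪(e : E n), (u : E n)⟫_ℝ ^ 2)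
      ∂(sphereMeasure n) = 0 := by
  have h3 := integral_homogeneous_mul_gaussian hn 3 (fun x => |⟪(e : E n), x⟫_ℝ| ^ 3)
    (fun u => |⟪(e : E n), (u : E n)⟫_ℝ| ^ 3)
    (fun r u hr => by rw [inner_smul_right, abs_mul, abs_of_pos hr, mul_pow])
  have h1 := integral_homogeneous_mul_gaussian hn 1 (fun x => |⟪(e : E n), x⟫_ℝ|)
    (fun u => |⟪(e : E n), (u : E n)⟫_ℝ|)
    (fun r u hr => by rw [inner_smul_right, abs_mul, abs_of_pos hr, pow_one])
  rw [integral_abs_inner_gaussian hn e, h1, show n - 1 + 3 = n + 2 by omega,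
    show n - 1 + 1 = n by omega, radialMoment_add_two] at h3
  have h4 : 2 * ∫ u : S n, |⟪(e : E n), (u : E n)⟫_ℝ| ∂(sphereMeasure n) =
      (n + 1) * ∫ u : S n, |⟪(e : E n), (u : E n)⟫_ℝ| ^ 3 ∂(sphereMeasure n) := by
    refine mul_right_cancel₀ (radialMoment_pos n).ne' ?_
    linarith
  rw [← integral_const_mul, ← integral_const_mul] at h4
  have hi : ∀ f : S n → ℝ, Continuous f → Integrable f (sphereMeasure n) := fun f hf =>
    hf.integrable_of_hasCompactSupport (HasCompactSupport.of_compactSpace _)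
  rw [← sub_eq_zero, ← integral_sub (hi _ (by fun_prop)) (hi _ (by fun_prop))] at h4
  rw [← h4]
  refine integral_congr_ae (Filter.Eventually.of_forall fun u => ?_)
  simp only [pow_succ |⟪(e : E n), (u : E n)⟫_ℝ| 2, sq_abs]
  ring

theorem integral_sphere_orthogonal_norm {n : ℕ} (hn : 0 < n) (e : S n) :
    ∫ u : S n, ‖(u : E n) - ⟪(e : E n), (u : E n)⟫_ℝ • (e : E n)‖ *
      ((n + 1) * ⟪(e : E n), (u : E n)⟫_ℝ ^ 2 - 1) ∂(sphereMeasure n) = 0 := by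
  have hs : ∀ (r : ℝ) (u : S n), 0 < r → ‖r • (u : E n) - ⟪(e : E n), r • (u : E n)⟫_ℝ •
      (e : E n)‖ = r * ‖(u : E n) - ⟪(e : E n), (u : E n)⟫_ℝ • (e : E n)‖ := by
    intro r u hr
    rw [inner_smul_right, mul_smul, ← smul_sub, norm_smul, Real.norm_eq_abs, abs_of_pos hr]
  have h3 := integral_homogeneous_mul_gaussian hn 3
    (fun x => ‖x - ⟪(e : E n), x⟫_ℝ • (e : E n)‖ * ⟪(e : E n), x⟫_ℝ ^ 2)
    (fun u => ‖(u : E n) - ⟪(e : E n), (u : E n)⟫_ℝ • (e : E n)‖ * ⟪(e : E n), (u : E n)⟫_ℝ ^ 2)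
    (fun r u hr => by rw [hs r u hr, inner_smul_right]; ring)
  have h1 := integral_homogeneous_mul_gaussian hn 1
    (fun x => ‖x - ⟪(e : E n), x⟫_ℝ • (e : E n)‖)
    (fun u => ‖(u : E n) - ⟪(e : E n), (u : E n)⟫_ℝ • (e : E n)‖)
    (fun r u hr => by rw [hs r u hr, pow_one])
  have hi1 : Integrable fun x : E n => ‖x - ⟪(e : E n), x⟫_ℝ • (e : E n)‖ *
      Real.exp (-‖x‖ ^ 2) := by
    refine integrable_mul_gaussian_of_le hn 1 (by fun_prop) fun x => ?_
    rw [abs_of_nonneg (norm_nonneg _)]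
    linarith [norm_sub_inner_smul_le e x, norm_nonneg x]
  have hi3 : Integrable fun x : E n => (‖x - ⟪(e : E n), x⟫_ℝ • (e : E n)‖ *
      ⟪(e : E n), x⟫_ℝ ^ 2) * Real.exp (-‖x‖ ^ 2) := by
    refine integrable_mul_gaussian_of_le hn 3 (by fun_prop) fun x => ?_
    rw [abs_mul, abs_of_nonneg (norm_nonneg _), abs_pow]
    have := mul_le_mul (norm_sub_inner_smul_le e x)
      (pow_le_pow_left₀ (abs_nonneg _) (abs_inner_le_norm_of_sphere e x) 2)
      (by positivity) (norm_nonneg x)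
    nlinarith [pow_nonneg (norm_nonneg x) 3]
  have h0 := integral_orthogonal_norm_gaussian hn e
  have e0 : ∀ x : E n, ‖x - ⟪(e : E n), x⟫_ℝ • (e : E n)‖ *
      ((1 - 2 * ⟪(e : E n), x⟫_ℝ ^ 2) * Real.exp (-‖x‖ ^ 2)) =
      ‖x - ⟪(e : E n), x⟫_ℝ • (e : E n)‖ * Real.exp (-‖x‖ ^ 2) -
      2 * ((‖x - ⟪(e : E n), x⟫_ℝ • (e : E n)‖ * ⟪(e : E n), x⟫_ℝ ^ 2) *
        Real.exp (-‖x‖ ^ 2)) := by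
    intro x
    ring
  simp only [e0] at h0
  rw [integral_sub hi1 (hi3.const_mul 2), integral_const_mul, h1, h3,
    show n - 1 + 3 = n + 2 by omega, show n - 1 + 1 = n by omega, radialMoment_add_two] at h0
  have hi : ∀ f : S n → ℝ, Continuous f → Integrable f (sphereMeasure n) := fun f hf =>
    hf.integrable_of_hasCompactSupport (HasCompactSupport.of_compactSpace _)
  have e4 : ∀ u : S n, ‖(u : E n) - ⟪(e : E n), (u : E n)⟫_ℝ • (e : E n)‖ *
      ((n + 1) * ⟪(e : E n), (u : E n)⟫_ℝ ^ 2 - 1) =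
      (n + 1) * (‖(u : E n) - ⟪(e : E n), (u : E n)⟫_ℝ • (e : E n)‖ *
        ⟪(e : E n), (u : E n)⟫_ℝ ^ 2) -
      ‖(u : E n) - ⟪(e : E n), (u : E n)⟫_ℝ • (e : E n)‖ := by
    intro u
    ring
  simp only [e4]
  rw [integral_sub (hi _ (by fun_prop)) (hi _ (by fun_prop)), integral_const_mul]
  refine mul_right_cancel₀ (radialMoment_pos n).ne' ?_
  linarith

/-! ### The box operator on the Legendre polynomials of degrees 0 and 2 -/

theorem fderiv_inner_sq_div_norm_sq {n : ℕ} (e : E n) {x : E n} (hx : x ≠ 0) (v : E n) :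
    fderiv ℝ (fun x : E n => ⟪e, x⟫_ℝ ^ 2 * (‖x‖ ^ 2)⁻¹) x v =
      2 * ⟪e, x⟫_ℝ * ⟪e, v⟫_ℝ * (‖x‖ ^ 2)⁻¹ -
        2 * ⟪e, x⟫_ℝ ^ 2 * ⟪x, v⟫_ℝ * ((‖x‖ ^ 2)⁻¹) ^ 2 := by
  have hN : ‖x‖ ^ 2 ≠ 0 := by positivity
  have h1 : HasFDerivAt (fun x : E n => ⟪e, x⟫_ℝ) (innerSL ℝ e) x := (innerSL ℝ e).hasFDerivAt
  have h2 := (hasStrictFDerivAt_norm_sq x).hasFDerivAt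
  have h3 := (hasDerivAt_inv hN).comp_hasFDerivAt x h2
  have h4 := (h1.pow 2).mul h3
  have h5 : HasFDerivAt (fun x : E n => ⟪e, x⟫_ℝ ^ 2 * (‖x‖ ^ 2)⁻¹) _ x := h4
  rw [h5.fderiv]
  simp
  ring

/-- On the line `u + t v` the first derivative in direction `v` is an explicit rational function of
`t`; its derivative at `0` is the second derivative sought. -/
theorem fderiv_fderiv_inner_sq_div_norm_sq {n : ℕ} (e : E n) (u : S n) (v : E n) :
    fderiv ℝ (fderiv ℝ (fun x : E n => ⟪e, x⟫_ℝ ^ 2 * (‖x‖ ^ 2)⁻¹)) (u : E n) v v =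
      2 * ⟪e, v⟫_ℝ ^ 2 - 8 * ⟪e, (u : E n)⟫_ℝ * (⟪e, v⟫_ℝ * ⟪v, (u : E n)⟫_ℝ) -
        2 * ⟪e, (u : E n)⟫_ℝ ^ 2 * ‖v‖ ^ 2 +
        8 * ⟪e, (u : E n)⟫_ℝ ^ 2 * ⟪v, (u : E n)⟫_ℝ ^ 2 := by
  have hu : (u : E n) ≠ 0 := ne_zero_of_mem_unit_sphere u
  set f : E n → ℝ := fun x => ⟪e, x⟫_ℝ ^ 2 * (‖x‖ ^ 2)⁻¹
  have hf : ContDiffAt ℝ 2 f (u : E n) := by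
    refine ContDiffAt.mul ?_ ?_
    · exact (contDiff_const.inner ℝ contDiff_id).contDiffAt.pow 2
    · exact (contDiff_norm_sq ℝ).contDiffAt.inv (by positivity)
  have hd : DifferentiableAt ℝ (fderiv ℝ f) (u : E n) :=
    (hf.fderiv_right (m := 1) (by norm_num)).differentiableAt (by norm_num)
  have h1 : HasFDerivAt (fun x => fderiv ℝ f x v)
      ((ContinuousLinearMap.apply ℝ ℝ v).comp (fderiv ℝ (fderiv ℝ f) (u : E n))) (u : E n) :=
    (ContinuousLinearMap.apply ℝ ℝ v).hasFDerivAt.comp (u : E n) hd.hasFDerivAt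
  have h2 := h1.hasLineDerivAt v
  rw [HasLineDerivAt] at h2
  have hev : ∀ᶠ t : ℝ in nhds 0, (u : E n) + t • v ≠ 0 := by
    have hc : ContinuousAt (fun t : ℝ => (u : E n) + t • v) 0 := by fun_prop
    exact hc.eventually_ne (by simpa using hu)
  have hN : ∀ t : ℝ, ‖(u : E n) + t • v‖ ^ 2 = 1 + 2 * t * ⟪v, (u : E n)⟫_ℝ + t ^ 2 * ‖v‖ ^ 2 := by
    intro t
    rw [norm_add_sq_real, norm_smul, norm_coe_sphere, inner_smul_right, real_inner_comm,
      Real.norm_eq_abs, mul_pow, sq_abs]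
    ring
  have h3 : (fun t : ℝ => fderiv ℝ f ((u : E n) + t • v) v) =ᶠ[nhds 0] fun t =>
      2 * (⟪e, (u : E n)⟫_ℝ + t * ⟪e, v⟫_ℝ) * ⟪e, v⟫_ℝ *
          (1 + 2 * t * ⟪v, (u : E n)⟫_ℝ + t ^ 2 * ‖v‖ ^ 2)⁻¹ -
        2 * (⟪e, (u : E n)⟫_ℝ + t * ⟪e, v⟫_ℝ) ^ 2 * (⟪v, (u : E n)⟫_ℝ + t * ‖v‖ ^ 2) *
          ((1 + 2 * t * ⟪v, (u : E n)⟫_ℝ + t ^ 2 * ‖v‖ ^ 2)⁻¹) ^ 2 := by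
    filter_upwards [hev] with t ht
    rw [fderiv_inner_sq_div_norm_sq e ht, hN, inner_add_right, inner_add_left, inner_smul_right,
      inner_smul_left, real_inner_self_eq_norm_sq, real_inner_comm (u : E n) v]
    rfl
  have h4 := h2.congr_of_eventuallyEq h3.symm
  have ha : HasDerivAt (fun t : ℝ => ⟪e, (u : E n)⟫_ℝ + t * ⟪e, v⟫_ℝ) ⟪e, v⟫_ℝ 0 := by
    simpa using ((hasDerivAt_id (0 : ℝ)).mul_const ⟪e, v⟫_ℝ).const_add ⟪e, (u : E n)⟫_ℝ
  have hb : HasDerivAt (fun t : ℝ => ⟪v, (u : E n)⟫_ℝ + t * ‖v‖ ^ 2) (‖v‖ ^ 2) 0 := by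
    simpa using ((hasDerivAt_id (0 : ℝ)).mul_const (‖v‖ ^ 2)).const_add ⟪v, (u : E n)⟫_ℝ
  have hc : HasDerivAt (fun t : ℝ => 1 + 2 * t * ⟪v, (u : E n)⟫_ℝ + t ^ 2 * ‖v‖ ^ 2)
      (2 * ⟪v, (u : E n)⟫_ℝ) 0 := by
    have h := ((((hasDerivAt_id (0 : ℝ)).const_mul 2).mul_const ⟪v, (u : E n)⟫_ℝ).const_add
      1).add (((hasDerivAt_id (0 : ℝ)).pow 2).mul_const (‖v‖ ^ 2))
    exact h.congr_deriv (by simp)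
  have hci := hc.fun_inv (by simp)
  have h5 := ((((ha.const_mul 2).mul_const ⟪e, v⟫_ℝ).mul hci).sub
    ((((ha.pow 2).const_mul 2).mul hb).mul (hci.pow 2)))
  have h6 := h4.unique h5
  change fderiv ℝ (fderiv ℝ f) (u : E n) v v = _ at h6
  rw [h6]
  simp
  ring

theorem laplacian_inner_sq_div_norm_sq {n : ℕ} (e u : S n) :
    Laplacian.laplacian (fun x : E n => ⟪(e : E n), x⟫_ℝ ^ 2 * (‖x‖ ^ 2)⁻¹) (u : E n) =
      2 - 2 * n * ⟪(e : E n), (u : E n)⟫_ℝ ^ 2 := by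
  let b := EuclideanSpace.basisFun (Fin n) ℝ
  rw [InnerProductSpace.laplacian_eq_iteratedFDeriv_orthonormalBasis _ b]
  simp only [iteratedFDeriv_two_apply, Matrix.cons_val_zero, Matrix.cons_val_one]
  -- By Parseval the four sums over the basis are `1`, `⟪e, u⟫`, `n` and `1`; the two terms with
  -- factor `8` cancel.
  simp only [fderiv_fderiv_inner_sq_div_norm_sq, Finset.sum_add_distrib, Finset.sum_sub_distrib,
    ← Finset.mul_sum, b.sum_sq_inner_left, b.sum_sq_inner_right, b.sum_inner_mul_inner]
  simp
  ring

theorem box_zonalLegendre_zero {n : ℕ} [NeZero n] (e u : S n) :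
    box n (zonalLegendre e 0) u = 1 := by
  have hu : (u : E n) ≠ 0 := ne_zero_of_mem_unit_sphere u
  have h1 : sphLaplacian (zonalLegendre e 0) u = 0 := by
    have h : homExt (zonalLegendre e 0) =ᶠ[nhds (u : E n)] fun _ => (1 : ℝ) := by
      filter_upwards [isOpen_ne.mem_nhds hu] with x hx
      rw [homExt, dif_pos hx]
      simp [zonalLegendre, legendre]
    rw [sphLaplacian, (InnerProductSpace.laplacian_congr_nhds h).eq_of_nhds]
    simp
  change ((n : ℝ) - 1)⁻¹ • sphLaplacian (zonalLegendre e 0) u + zonalLegendre e 0 u = 1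
  rw [h1]
  simp [zonalLegendre, legendre]

theorem eval_legendre_two (n : ℕ) (t : ℝ) :
    (legendre n 2).eval t = ((n : ℝ) - 1)⁻¹ * (n * t ^ 2 - 1) := by
  simp only [legendre, Polynomial.eval_mul, Polynomial.eval_C, Polynomial.eval_sub,
    Polynomial.eval_X, Polynomial.eval_one]
  push_cast
  ring_nf

/-- The eigenvalue of `□ₙ` on `P_2` is `1 - 2n/(n-1) = -(n+1)/(n-1)`; the remaining factor `(n-1)⁻¹`
comes from `P_2` itself. -/
theorem box_zonalLegendre_two {n : ℕ} [NeZero n] (hn : 3 ≤ n) (e u : S n) :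
    box n (zonalLegendre e 2) u =
      -((n + 1) / ((n : ℝ) - 1) ^ 2) * (n * ⟪(e : E n), (u : E n)⟫_ℝ ^ 2 - 1) := by
  have hu : (u : E n) ≠ 0 := ne_zero_of_mem_unit_sphere u
  have hn1 : (n : ℝ) - 1 ≠ 0 := by
    have : (3 : ℝ) ≤ n := by exact_mod_cast hn
    linarith
  set f : E n → ℝ := fun x => ⟪(e : E n), x⟫_ℝ ^ 2 * (‖x‖ ^ 2)⁻¹ with hfdef
  have hf : ContDiffAt ℝ 2 f (u : E n) := by
    refine ContDiffAt.mul ?_ ?_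
    · exact (contDiff_const.inner ℝ contDiff_id).contDiffAt.pow 2
    · exact (contDiff_norm_sq ℝ).contDiffAt.inv (by positivity)
  have h1 : sphLaplacian (zonalLegendre e 2) u =
      ((n : ℝ) - 1)⁻¹ * (n * (2 - 2 * n * ⟪(e : E n), (u : E n)⟫_ℝ ^ 2)) := by
    have h : homExt (zonalLegendre e 2) =ᶠ[nhds (u : E n)]
        ((((n : ℝ) - 1)⁻¹ * n) • f) + fun _ => -((n : ℝ) - 1)⁻¹ := by
      filter_upwards [isOpen_ne.mem_nhds hu] with x hx
      rw [homExt, dif_pos hx]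
      change (legendre n 2).eval ⟪(e : E n), ‖x‖⁻¹ • x⟫_ℝ = _
      rw [eval_legendre_two, inner_smul_right]
      simp only [Pi.add_apply, Pi.smul_apply, hfdef, smul_eq_mul, mul_pow, inv_pow]
      ring
    have hcf : ContDiffAt ℝ 2 ((((n : ℝ) - 1)⁻¹ * n) • f) (u : E n) :=
      hf.const_smul (((n : ℝ) - 1)⁻¹ * n)
    rw [sphLaplacian, (InnerProductSpace.laplacian_congr_nhds h).eq_of_nhds,
      hcf.laplacian_add
        contDiffAt_const,
      InnerProductSpace.laplacian_smul _ hf, laplacian_inner_sq_div_norm_sq]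
    simp
    ring
  change ((n : ℝ) - 1)⁻¹ • sphLaplacian (zonalLegendre e 2) u +
    (legendre n 2).eval ⟪(e : E n), (u : E n)⟫_ℝ = _
  rw [h1, eval_legendre_two, smul_eq_mul]
  field_simp
  ring

theorem multiplier_zero {n : ℕ} [NeZero n] (e : S n) (h : C(S n, ℝ)) :
    multiplier e 0 (boxDual (toDual h)) = ∫ u, h u ∂(sphereMeasure n) := by
  change ∫ u : S n, h u * box n (zonalLegendre e 0) u ∂(sphereMeasure n) = _
  simp only [box_zonalLegendre_zero, mul_one]

theorem multiplier_two {n : ℕ} [NeZero n] (hn : 3 ≤ n) (e : S n) (h : C(S n, ℝ)) :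
    multiplier e 2 (boxDual (toDual h)) = -((n + 1) / ((n : ℝ) - 1) ^ 2) *
      ∫ u, h u * (n * ⟪(e : E n), (u : E n)⟫_ℝ ^ 2 - 1) ∂(sphereMeasure n) := by
  change ∫ u : S n, h u * box n (zonalLegendre e 2) u ∂(sphereMeasure n) = _
  simp only [box_zonalLegendre_two hn]
  rw [← integral_const_mul]
  congr 1
  ext u
  ring

/-! ### Support and width as sublinear functions -/

/-- The support function of `L`, as a sublinear function on `ℝⁿ`. -/
def supp {n : ℕ} (L : ConvexBody (E n)) (x : E n) : ℝ :=
  sSup ((fun y : E n => ⟪y, x⟫_ℝ) '' (L : Set (E n)))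

/-- The width function `x ↦ h_L(x) + h_L(-x)` of `L`. -/
def width {n : ℕ} (L : ConvexBody (E n)) (x : E n) : ℝ := supp L x + supp L (-x)

theorem inner_le_supp {n : ℕ} (L : ConvexBody (E n)) {y : E n} (hy : y ∈ (L : Set (E n)))
    (x : E n) : ⟪y, x⟫_ℝ ≤ supp L x :=
  le_csSup (L.isCompact.image (by fun_prop)).bddAbove (mem_image_of_mem _ hy)

theorem supp_le {n : ℕ} {L : ConvexBody (E n)} {x : E n} {c : ℝ}
    (h : ∀ y ∈ (L : Set (E n)), ⟪y, x⟫_ℝ ≤ c) : supp L x ≤ c :=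
  csSup_le (L.nonempty.image _) (forall_mem_image.2 h)

theorem supp_add_le {n : ℕ} (L : ConvexBody (E n)) (x y : E n) :
    supp L (x + y) ≤ supp L x + supp L y :=
  supp_le fun z hz => by
    rw [inner_add_right]
    exact add_le_add (inner_le_supp L hz x) (inner_le_supp L hz y)

theorem supp_smul_le {n : ℕ} (L : ConvexBody (E n)) {c : ℝ} (hc : 0 ≤ c) (x : E n) :
    supp L (c • x) ≤ c * supp L x :=
  supp_le fun z hz => by
    rw [inner_smul_right]
    exact mul_le_mul_of_nonneg_left (inner_le_supp L hz x) hc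

theorem abs_inner_sub_le_width {n : ℕ} (L : ConvexBody (E n)) {y z : E n}
    (hy : y ∈ (L : Set (E n))) (hz : z ∈ (L : Set (E n))) (x : E n) :
    |⟪y - z, x⟫_ℝ| ≤ width L x := by
  have h1 := inner_le_supp L hy x
  have h2 := inner_le_supp L hz x
  have h3 := inner_le_supp L hy (-x)
  have h4 := inner_le_supp L hz (-x)
  rw [inner_neg_right] at h3 h4
  rw [inner_sub_left, abs_le, width]
  constructor <;> linarith

theorem width_nonneg {n : ℕ} (L : ConvexBody (E n)) (x : E n) : 0 ≤ width L x := by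
  obtain ⟨y, hy⟩ := L.nonempty
  exact (abs_nonneg _).trans (abs_inner_sub_le_width L hy hy x)

theorem width_neg {n : ℕ} (L : ConvexBody (E n)) (x : E n) : width L (-x) = width L x := by
  rw [width, width, neg_neg, add_comm]

theorem width_add_le {n : ℕ} (L : ConvexBody (E n)) (x y : E n) :
    width L (x + y) ≤ width L x + width L y := by
  have h1 := supp_add_le L x y
  have h2 := supp_add_le L (-x) (-y)
  rw [← neg_add] at h2
  simp only [width]
  linarith

theorem width_smul_le {n : ℕ} (L : ConvexBody (E n)) {c : ℝ} (hc : 0 ≤ c) (x : E n) :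
    width L (c • x) ≤ c * width L x := by
  have h1 := supp_smul_le L hc x
  have h2 := supp_smul_le L hc (-x)
  rw [smul_neg] at h2
  simp only [width]
  linarith

theorem width_smul {n : ℕ} (L : ConvexBody (E n)) {c : ℝ} (hc : 0 ≤ c) (x : E n) :
    width L (c • x) = c * width L x := by
  refine le_antisymm (width_smul_le L hc x) ?_
  rcases hc.eq_or_lt with rfl | hc
  · simpa using width_nonneg L 0
  · have h := width_smul_le L (inv_nonneg.2 hc.le) (c • x)
    rw [smul_smul, inv_mul_cancel₀ hc.ne', one_smul] at h
    calc c * width L x ≤ c * (c⁻¹ * width L (c • x)) := mul_le_mul_of_nonneg_left h hc.le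
      _ = width L (c • x) := by rw [← mul_assoc, mul_inv_cancel₀ hc.ne', one_mul]

/-- If `W(p - q) = W(p + q)`, convexity makes `λ ↦ W(p + λ q)` at most `W(p + q)` on `[0, 1]`. -/
theorem width_add_smul_le {n : ℕ} (L : ConvexBody (E n)) {p q : E n}
    (h : width L (p - q) = width L (p + q)) {c : ℝ} (h0 : 0 ≤ c) (h1 : c ≤ 1) :
    width L (p + c • q) ≤ width L (p + q) := by
  have e1 : p + c • q = ((1 + c) / 2) • (p + q) + ((1 - c) / 2) • (p - q) := by module
  rw [e1]
  refine (width_add_le L _ _).trans ?_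
  rw [width_smul L (by linarith), width_smul L (by linarith), h]
  linarith

/-! ### Rotational symmetry and monotonicity of the width -/

theorem exists_unit_orthogonal {n : ℕ} (hn : 3 ≤ n) (x y : E n) :
    ∃ z : E n, ‖z‖ = 1 ∧ ⟪x, z⟫_ℝ = 0 ∧ ⟪y, z⟫_ℝ = 0 := by
  set K : Submodule ℝ (E n) := Submodule.span ℝ {x, y}
  have hK : Module.finrank ℝ K ≤ 2 := by
    have h := finrank_span_finset_le_card (R := ℝ) ({x, y} : Finset (E n))
    have h2 := Finset.card_le_two (a := x) (b := y)
    simp only [Finset.coe_pair] at h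
    exact h.trans h2
  have hsum := K.finrank_add_finrank_orthogonal
  rw [finrank_euclideanSpace_fin] at hsum
  have hpos : 0 < Module.finrank ℝ Kᗮ := by omega
  have : Nontrivial Kᗮ := Module.nontrivial_of_finrank_pos hpos
  obtain ⟨z, hz⟩ := exists_ne (0 : Kᗮ)
  have hz0 : (z : E n) ≠ 0 := by simpa using hz
  have hx : ⟪x, (z : E n)⟫_ℝ = 0 :=
    Submodule.inner_right_of_mem_orthogonal (Submodule.subset_span (by simp)) z.2
  have hy : ⟪y, (z : E n)⟫_ℝ = 0 :=
    Submodule.inner_right_of_mem_orthogonal (Submodule.subset_span (by simp)) z.2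
  refine ⟨‖(z : E n)‖⁻¹ • (z : E n), by simp [norm_smul, hz0], ?_, ?_⟩ <;>
    simp [inner_smul_right, hx, hy]

theorem det_reflection_singleton {n : ℕ} {z : E n} (hz : z ≠ 0) :
    LinearMap.det ((ℝ ∙ z)ᗮ.reflection.toLinearEquiv : E n →ₗ[ℝ] E n) = -1 := by
  have h := (ℝ ∙ z)ᗮ.det_reflection
  rw [Submodule.orthogonal_orthogonal, finrank_span_singleton hz, pow_one] at h
  exact h

/-- The reflection exchanging `x` and `y` fixes `e` but has determinant `-1`. Following it by the
reflection in a direction orthogonal to both `e` and `y`, available since `n ≥ 3`, gives a rotation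
that still fixes `e` and takes `x` to `y`. -/
theorem mem_of_isBodyOfRevolution {n : ℕ} (hn : 3 ≤ n) {e : S n} {L : ConvexBody (E n)}
    (hL : IsBodyOfRevolution e L) {x y : E n} (hx : x ∈ (L : Set (E n))) (hxy : ‖x‖ = ‖y‖)
    (hi : ⟪(e : E n), x⟫_ℝ = ⟪(e : E n), y⟫_ℝ) : y ∈ (L : Set (E n)) := by
  rcases eq_or_ne x y with rfl | hne
  · exact hx
  obtain ⟨z, hz1, hze, hzy⟩ := exists_unit_orthogonal hn (e : E n) y
  have hz0 : z ≠ 0 := by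
    rintro rfl
    simp at hz1
  have hfix : ∀ a b : E n, ⟪b, a⟫_ℝ = 0 → (ℝ ∙ a)ᗮ.reflection b = b := fun a b h => by
    rw [Submodule.reflection_eq_self_iff, Submodule.mem_orthogonal_singleton_iff_inner_right,
      real_inner_comm]
    exact h
  let θ : E n ≃ₗᵢ[ℝ] E n := (ℝ ∙ (x - y))ᗮ.reflection.trans (ℝ ∙ z)ᗮ.reflection
  have hθ : θ '' (L : Set (E n)) = L := by
    refine hL θ ?_ ?_
    · have : (θ.toLinearEquiv : E n →ₗ[ℝ] E n) =
          ((ℝ ∙ z)ᗮ.reflection.toLinearEquiv : E n →ₗ[ℝ] E n) ∘ₗ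
          ((ℝ ∙ (x - y))ᗮ.reflection.toLinearEquiv : E n →ₗ[ℝ] E n) := rfl
      rw [this, LinearMap.det_comp, det_reflection_singleton hz0,
        det_reflection_singleton (sub_ne_zero.2 hne)]
      norm_num
    · change (ℝ ∙ z)ᗮ.reflection ((ℝ ∙ (x - y))ᗮ.reflection (e : E n)) = e
      rw [hfix (x - y) e (by rw [inner_sub_right, hi, sub_self]), hfix z e hze]
  have hmem : θ x ∈ θ '' (L : Set (E n)) := mem_image_of_mem _ hx
  have hval : θ x = y := by
    change (ℝ ∙ z)ᗮ.reflection ((ℝ ∙ (x - y))ᗮ.reflection x) = y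
    rw [Submodule.reflection_sub hxy, hfix z y hzy]
  rwa [hθ, hval] at hmem

section Revolution

variable {n : ℕ} {e : S n} {L : ConvexBody (E n)}

/-- The reflection exchanging `x` and `y` preserves norms and heights along `e`, so it maps `L` into
itself by `mem_of_isBodyOfRevolution`, although it is not a rotation. -/
theorem supp_le_of_isBodyOfRevolution (hn : 3 ≤ n) (hL : IsBodyOfRevolution e L) {x y : E n}
    (hxy : ‖x‖ = ‖y‖) (hi : ⟪(e : E n), x⟫_ℝ = ⟪(e : E n), y⟫_ℝ) : supp L x ≤ supp L y := by
  refine supp_le fun z hz => ?_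
  set ρ := (ℝ ∙ (x - y))ᗮ.reflection
  have hρx : ρ x = y := Submodule.reflection_sub hxy
  have hρe : ρ (e : E n) = e := by
    rw [Submodule.reflection_eq_self_iff, Submodule.mem_orthogonal_singleton_iff_inner_right,
      inner_sub_left, real_inner_comm, hi, real_inner_comm, sub_self]
  have hmem : ρ z ∈ (L : Set (E n)) := by
    refine mem_of_isBodyOfRevolution hn hL hz (ρ.norm_map z).symm ?_
    conv_rhs => rw [← hρe]
    rw [ρ.inner_map_map]
  rw [← ρ.inner_map_map z x, hρx]
  exact inner_le_supp L hmem y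

theorem width_eq_of_isBodyOfRevolution (hn : 3 ≤ n) (hL : IsBodyOfRevolution e L) {x y : E n}
    (hxy : ‖x‖ ^ 2 = ‖y‖ ^ 2) (hi : |⟪(e : E n), x⟫_ℝ| = |⟪(e : E n), y⟫_ℝ|) :
    width L x = width L y := by
  have hxy' : ‖x‖ = ‖y‖ := by
    rwa [sq_eq_sq₀ (norm_nonneg _) (norm_nonneg _)] at hxy
  have key : ∀ z : E n, ‖x‖ = ‖z‖ → ⟪(e : E n), x⟫_ℝ = ⟪(e : E n), z⟫_ℝ →
      width L x = width L z := by
    intro z h1 h2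
    have h1n : ‖-x‖ = ‖-z‖ := by rw [norm_neg, norm_neg, h1]
    have h2n : ⟪(e : E n), -x⟫_ℝ = ⟪(e : E n), -z⟫_ℝ := by
      rw [inner_neg_right, inner_neg_right, h2]
    rw [width, width,
      le_antisymm (supp_le_of_isBodyOfRevolution hn hL h1 h2)
        (supp_le_of_isBodyOfRevolution hn hL h1.symm h2.symm),
      le_antisymm (supp_le_of_isBodyOfRevolution hn hL h1n h2n)
        (supp_le_of_isBodyOfRevolution hn hL h1n.symm h2n.symm)]
  rcases abs_eq_abs.1 hi with h | h
  · exact key y hxy' h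
  · rw [← width_neg L y]
    exact key (-y) (by rw [norm_neg, hxy']) (by rw [inner_neg_right, h])

theorem norm_sq_smul_add_smul {w : E n} (hw : ‖w‖ = 1) (hwe : ⟪(e : E n), w⟫_ℝ = 0) (t s : ℝ) :
    ‖t • (e : E n) + s • w‖ ^ 2 = t ^ 2 + s ^ 2 := by
  rw [norm_add_sq_real, norm_smul, norm_smul, norm_coe_sphere, hw, inner_smul_left,
    inner_smul_right, hwe, Real.norm_eq_abs, Real.norm_eq_abs, mul_one, mul_one, sq_abs, sq_abs]
  simp

theorem inner_smul_add_smul {w : E n} (hwe : ⟪(e : E n), w⟫_ℝ = 0) (t s : ℝ) :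
    ⟪(e : E n), t • (e : E n) + s • w⟫_ℝ = t := by
  rw [inner_add_right, inner_smul_right, inner_smul_right, hwe, inner_self_sphere]
  simp

/-- Monotonicity of the width in both cylindrical coordinates. -/
theorem width_mono (hn : 3 ≤ n) (hL : IsBodyOfRevolution e L) {w : E n} (hw : ‖w‖ = 1)
    (hwe : ⟪(e : E n), w⟫_ℝ = 0) {t t' s s' : ℝ} (ht : 0 ≤ t) (htt : t ≤ t') (hs : 0 ≤ s)
    (hss : s ≤ s') :
    width L (t • (e : E n) + s • w) ≤ width L (t' • (e : E n) + s' • w) := by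
  have hsq : ∀ a b c d : ℝ, a ^ 2 = c ^ 2 → b ^ 2 = d ^ 2 →
      width L (a • (e : E n) + b • w) = width L (c • (e : E n) + d • w) := by
    intro a b c d h1 h2
    refine width_eq_of_isBodyOfRevolution hn hL ?_ ?_
    · rw [norm_sq_smul_add_smul hw hwe, norm_sq_smul_add_smul hw hwe, h1, h2]
    · rw [inner_smul_add_smul hwe, inner_smul_add_smul hwe]
      exact (sq_eq_sq_iff_abs_eq_abs _ _).1 h1
  -- If `b = 0` then `a = 0`, and the convention `0 / 0 = 0` keeps all three claims true.
  have hdiv : ∀ {a b : ℝ}, 0 ≤ a → a ≤ b → 0 ≤ a / b ∧ a / b ≤ 1 ∧ a = a / b * b := by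
    intro a b ha hab
    refine ⟨div_nonneg ha (ha.trans hab), div_le_one_of_le₀ hab (ha.trans hab), ?_⟩
    rcases eq_or_ne b 0 with rfl | hb
    · simpa using le_antisymm hab ha
    · rw [div_mul_cancel₀ _ hb]
  calc width L (t • (e : E n) + s • w) ≤ width L (t' • (e : E n) + s • w) := by
        obtain ⟨h0, h1, h2⟩ := hdiv ht htt
        have h := width_add_smul_le L (p := s • w) (q := t' • (e : E n)) (by
          have := hsq (-t') s t' s (by ring) rfl
          rw [add_comm (s • w), ← this]
          congr 1
          module) h0 h1
        rwa [smul_smul, ← h2, add_comm, add_comm (s • w)] at h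
    _ ≤ width L (t' • (e : E n) + s' • w) := by
        obtain ⟨h0, h1, h2⟩ := hdiv hs hss
        have h := width_add_smul_le L (p := t' • (e : E n)) (q := s' • w) (by
          have := hsq t' (-s') t' s' rfl (by ring)
          rw [← this]
          congr 1
          module) h0 h1
        rwa [smul_smul, ← h2] at h

/-- The width in cylindrical coordinates. -/
theorem width_eq_cylindrical (hn : 3 ≤ n) (hL : IsBodyOfRevolution e L) {w : E n} (hw : ‖w‖ = 1)
    (hwe : ⟪(e : E n), w⟫_ℝ = 0) (x : E n) :
    width L x = width L (|⟪(e : E n), x⟫_ℝ| • (e : E n) +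
      ‖x - ⟪(e : E n), x⟫_ℝ • (e : E n)‖ • w) := by
  refine width_eq_of_isBodyOfRevolution hn hL ?_ ?_
  · rw [norm_sq_smul_add_smul hw hwe, norm_sub_inner_smul_sq, sq_abs]
    ring
  · rw [inner_smul_add_smul hwe, abs_abs]

/-- Comparison of the width with that of a disk. -/
theorem exists_disk_comparison (hn : 3 ≤ n) (hL : IsBodyOfRevolution e L) :
    ∃ C : ℝ, ∀ u : S n, 0 ≤ (width L u - C * ‖(u : E n) - ⟪(e : E n), (u : E n)⟫_ℝ • (e : E n)‖) *
      ((n + 1) * ⟪(e : E n), (u : E n)⟫_ℝ ^ 2 - 1) := by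
  obtain ⟨w, hw, hwe, -⟩ := exists_unit_orthogonal hn (e : E n) 0
  have hn0 : (0 : ℝ) < n := by exact_mod_cast (by omega : 0 < n)
  -- `C` is the value of `W / s` at the zero of the weight: `(n + 1) t² = 1` and `t² + s² = 1` give
  -- `|t| / s = 1 / √n`.
  refine ⟨width L ((√n)⁻¹ • (e : E n) + (1 : ℝ) • w), fun u => ?_⟩
  have hs := norm_sub_inner_smul_sq e (u : E n)
  rw [norm_coe_sphere, one_pow] at hs
  rw [width_eq_cylindrical hn hL hw hwe (u : E n)]
  set t := ⟪(e : E n), (u : E n)⟫_ℝ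
  set s := ‖(u : E n) - t • (e : E n)‖
  have hs0 : 0 ≤ s := norm_nonneg _
  have hq0 : 0 ≤ s * (√n)⁻¹ := by positivity
  have hq : (s * (√n)⁻¹) ^ 2 * n = 1 - t ^ 2 := by
    rw [mul_pow, inv_pow, Real.sq_sqrt hn0.le, mul_assoc, inv_mul_cancel₀ hn0.ne', hs, mul_one]
  -- By homogeneity `C s` is the width at `(s / √n, s)`, so only the first coordinates differ and
  -- `width_mono` applies.
  rw [mul_comm _ s, ← width_smul L hs0, smul_add, smul_smul, smul_smul, mul_one]
  rcases le_total 1 ((n + 1) * t ^ 2) with h | h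
  · refine mul_nonneg (sub_nonneg.2 (width_mono hn hL hw hwe hq0 ?_ hs0 le_rfl)) (by linarith)
    refine le_of_sq_le_sq ?_ (abs_nonneg t)
    rw [sq_abs]
    refine le_of_mul_le_mul_right ?_ hn0
    linarith
  · refine mul_nonneg_of_nonpos_of_nonpos
      (sub_nonpos.2 (width_mono hn hL hw hwe (abs_nonneg t) ?_ hs0 le_rfl)) (by linarith)
    refine le_of_sq_le_sq ?_ hq0
    rw [sq_abs]
    refine le_of_mul_le_mul_right ?_ hn0
    linarith

/-- Comparison of the width with that of a segment. -/
theorem exists_segment_comparison (hn : 3 ≤ n) (hL : IsBodyOfRevolution e L) :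
    ∃ C : ℝ, ∀ u : S n, 0 ≤ (width L u - C * |⟪(e : E n), (u : E n)⟫_ℝ|) *
      (2 - (n + 1) * ⟪(e : E n), (u : E n)⟫_ℝ ^ 2) := by
  obtain ⟨w, hw, hwe, -⟩ := exists_unit_orthogonal hn (e : E n) 0
  have hn3 : (3 : ℝ) ≤ n := by exact_mod_cast hn
  -- `C` is the value of `W / |t|` at the zero of the weight: `(n + 1) t² = 2` gives `s² / t² = (n -
  -- 1) / 2`.
  refine ⟨width L ((1 : ℝ) • (e : E n) + √((n - 1) / 2) • w), fun u => ?_⟩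
  have hs := norm_sub_inner_smul_sq e (u : E n)
  rw [norm_coe_sphere, one_pow] at hs
  rw [width_eq_cylindrical hn hL hw hwe (u : E n)]
  set t := ⟪(e : E n), (u : E n)⟫_ℝ
  set s := ‖(u : E n) - t • (e : E n)‖
  have hs0 : 0 ≤ s := norm_nonneg _
  have hq0 : 0 ≤ |t| * √((n - 1) / 2) := by positivity
  have hq : (|t| * √((n - 1) / 2)) ^ 2 = t ^ 2 * ((n - 1) / 2) := by
    rw [mul_pow, sq_abs, Real.sq_sqrt (by linarith)]
  rw [mul_comm _ |t|, ← width_smul L (abs_nonneg t), smul_add, smul_smul, smul_smul, mul_one]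
  rcases le_total ((n + 1) * t ^ 2) 2 with h | h
  · refine mul_nonneg (sub_nonneg.2 (width_mono hn hL hw hwe (abs_nonneg t) le_rfl hq0 ?_))
      (by linarith)
    refine le_of_sq_le_sq ?_ hs0
    rw [hq, hs]
    linarith
  · refine mul_nonneg_of_nonpos_of_nonpos
      (sub_nonpos.2 (width_mono hn hL hw hwe (abs_nonneg t) le_rfl hs0 ?_)) (by linarith)
    refine le_of_sq_le_sq ?_ hq0
    rw [hq, hs]
    linarith

end Revolution

/-! ### Vanishing widths, disks and segments -/

section Shapes

variable {n : ℕ} {e : S n} {L : ConvexBody (E n)}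

theorem inner_eq_of_width_eq_zero {x : E n} (hx : width L x = 0) {y z : E n}
    (hy : y ∈ (L : Set (E n))) (hz : z ∈ (L : Set (E n))) : ⟪y - z, x⟫_ℝ = 0 := by
  have h := abs_inner_sub_le_width L hy hz x
  rw [hx] at h
  exact abs_nonpos_iff.1 h

/-- The mirror image of `z` in the axis has the same width as `z`, and the two add up to twice the
axial part of `z`; subadditivity concludes. -/
theorem width_inner_smul_eq_zero (hn : 3 ≤ n) (hL : IsBodyOfRevolution e L) {z : E n}
    (hz : width L z = 0) : width L (⟪(e : E n), z⟫_ℝ • (e : E n)) = 0 := by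
  set t := ⟪(e : E n), z⟫_ℝ with ht
  have h1 : width L (t • (e : E n) + (-1 : ℝ) • (z - t • (e : E n))) = width L z := by
    refine width_eq_of_isBodyOfRevolution hn hL ?_ ?_
    · have : t • (e : E n) + (-1 : ℝ) • (z - t • (e : E n)) = (2 * t) • (e : E n) - z := by module
      rw [this, norm_sub_sq_real, norm_smul, inner_smul_left, ← ht, norm_coe_sphere,
        Real.norm_eq_abs, mul_one, sq_abs]
      simp
      ring
    · rw [inner_add_right, inner_smul_right, inner_smul_right, inner_sub_right, inner_smul_right,
        inner_self_sphere, ← ht]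
      simp
  have h2 := width_add_le L z (t • (e : E n) + (-1 : ℝ) • (z - t • (e : E n)))
  have e2 : z + (t • (e : E n) + (-1 : ℝ) • (z - t • (e : E n))) = (2 : ℝ) • t • (e : E n) := by
    module
  rw [h1, hz, e2, width_smul L zero_le_two] at h2
  linarith [width_nonneg L (t • (e : E n))]

theorem width_axis_eq_zero (hn : 3 ≤ n) (hL : IsBodyOfRevolution e L) {z : E n}
    (hz : width L z = 0) (hez : ⟪(e : E n), z⟫_ℝ ≠ 0) : width L (e : E n) = 0 := by
  have h := width_inner_smul_eq_zero hn hL hz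
  have h2 := width_smul L (inv_nonneg.2 (abs_nonneg ⟪(e : E n), z⟫_ℝ))
    (⟪(e : E n), z⟫_ℝ • (e : E n))
  rw [h, mul_zero, smul_smul] at h2
  rw [← h2]
  refine width_eq_of_isBodyOfRevolution hn hL ?_ ?_
  · rw [norm_smul, norm_mul, norm_inv, Real.norm_eq_abs, Real.norm_eq_abs, abs_abs,
      inv_mul_cancel₀ (abs_ne_zero.2 hez), one_mul]
  · rw [inner_smul_right, inner_self_sphere, mul_one, abs_mul, abs_inv, abs_abs,
      inv_mul_cancel₀ (abs_ne_zero.2 hez), abs_one]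

/-- All directions orthogonal to the axis are equivalent. -/
theorem width_eq_zero_of_orthogonal (hn : 3 ≤ n) (hL : IsBodyOfRevolution e L) {w v : E n}
    (hw : ‖w‖ = 1) (hwe : ⟪(e : E n), w⟫_ℝ = 0) (hw0 : width L w = 0)
    (hve : ⟪(e : E n), v⟫_ℝ = 0) : width L v = 0 := by
  have h : width L v = width L (‖v‖ • w) := by
    refine width_eq_of_isBodyOfRevolution hn hL ?_ ?_
    · rw [norm_smul, hw, norm_norm, mul_one]
    · rw [inner_smul_right, hwe, hve, mul_zero]
  rw [h, width_smul L (norm_nonneg v), hw0, mul_zero]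

/-- Zero width along `e` puts `L` in a hyperplane orthogonal to `e`. Rotating a point of `L`
farthest from the axis sweeps out the boundary sphere of the disk, and convexity fills it. -/
theorem isDisk_of_width_axis_eq_zero (hn : 3 ≤ n) (hL : IsBodyOfRevolution e L)
    (hpt : (L : Set (E n)).Nontrivial) (h0 : width L (e : E n) = 0) :
    IsDisk (L : Set (E n)) := by
  obtain ⟨z, hz⟩ := L.nonempty
  set a := ⟪(e : E n), z⟫_ℝ with ha
  set c : E n := a • (e : E n) with hc
  have hconst : ∀ y ∈ (L : Set (E n)), ⟪(e : E n), y - c⟫_ℝ = 0 := by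
    intro y hy
    have h := inner_eq_of_width_eq_zero h0 hy hz
    rw [real_inner_comm, inner_sub_right] at h
    rw [inner_sub_right, hc, inner_smul_right, inner_self_sphere, mul_one]
    exact h
  obtain ⟨x, hx, hmax⟩ := L.isCompact.exists_isMaxOn L.nonempty
    (f := fun y : E n => ‖y - c‖) (by fun_prop)
  have hmax' : ∀ y ∈ (L : Set (E n)), ‖y - c‖ ≤ ‖x - c‖ := fun y hy => hmax hy
  have hpyth : ∀ p : E n, ⟪(e : E n), p⟫_ℝ = 0 → ‖c + p‖ ^ 2 = a ^ 2 + ‖p‖ ^ 2 := by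
    intro p hp
    rw [norm_add_sq_real, hc, norm_smul, norm_coe_sphere, inner_smul_left, hp,
      Real.norm_eq_abs, mul_one, sq_abs]
    simp
  have hrot : ∀ p : E n, ⟪(e : E n), p⟫_ℝ = 0 → ‖p‖ = ‖x - c‖ → c + p ∈ (L : Set (E n)) := by
    intro p hp hpn
    have hxe := hconst x hx
    refine mem_of_isBodyOfRevolution hn hL hx ?_ ?_
    · rw [← sq_eq_sq₀ (norm_nonneg _) (norm_nonneg _), hpyth p hp, hpn, ← hpyth _ hxe,
        add_sub_cancel]
    · rw [inner_sub_right, sub_eq_zero] at hxe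
      rw [inner_add_right, hp, hxe, add_zero]
  have hr : 0 < ‖x - c‖ := by
    obtain ⟨p, hp, q, hq, hpq⟩ := hpt
    by_contra hcon
    have hc0 : ∀ y ∈ (L : Set (E n)), y = c := fun y hy =>
      sub_eq_zero.1 (norm_le_zero_iff.1 ((hmax' y hy).trans (not_lt.1 hcon)))
    exact hpq ((hc0 p hp).trans (hc0 q hq).symm)
  refine ⟨c, e, ‖x - c‖, hr, Subset.antisymm (fun y hy => ?_) fun y hy => ?_⟩
  · exact ⟨by rw [real_inner_comm]; exact hconst y hy, hmax' y hy⟩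
  · obtain ⟨hye, hyr⟩ := hy
    rw [real_inner_comm] at hye
    -- Each point of the disk is `c + l p` with `p` of maximal length; at the centre any such `p`
    -- serves, with `l = 0`.
    obtain ⟨p, l, hpe, hpn, hl0, hl1, hyp⟩ : ∃ (p : E n) (l : ℝ), ⟪(e : E n), p⟫_ℝ = 0 ∧
        ‖p‖ = ‖x - c‖ ∧ 0 ≤ l ∧ l ≤ 1 ∧ y - c = l • p := by
      by_cases hd : y - c = 0
      · exact ⟨x - c, 0, hconst x hx, rfl, le_rfl, zero_le_one, by rw [hd, zero_smul]⟩
      · have hdn : 0 < ‖y - c‖ := norm_pos_iff.2 hd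
        refine ⟨(‖x - c‖ / ‖y - c‖) • (y - c), ‖y - c‖ / ‖x - c‖, ?_, ?_, by positivity,
          (div_le_one hr).2 hyr, ?_⟩
        · rw [inner_smul_right, hye, mul_zero]
        · rw [norm_smul, Real.norm_eq_abs, abs_of_pos (by positivity), div_mul_cancel₀ _ hdn.ne']
        · rw [smul_smul, div_mul_div_cancel₀ hr.ne', div_self hdn.ne', one_smul]
    have h1 := hrot p hpe hpn
    have h2 := hrot (-p) (by rw [inner_neg_right, hpe, neg_zero]) (by rw [norm_neg, hpn])
    -- The point lies on the diameter from `c - p` to `c + p`.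
    have h3 := L.convex h1 h2 (a := (1 + l) / 2) (b := (1 - l) / 2) (by linarith) (by linarith)
      (by ring)
    have e3 : ((1 + l) / 2) • (c + p) + ((1 - l) / 2) • (c + -p) = c + l • p := by module
    rw [e3, ← hyp, add_sub_cancel] at h3
    exact h3

/-- The transversal part `p` of a difference of two points is orthogonal to that difference, since
`W(p) = 0`, and hence to itself. All differences are thus parallel to `e`, and the endpoints are the
extremes of `⟪e, ·⟫` on `L`. -/
theorem isLineSegment_of_width_orthogonal_eq_zero (hpt : (L : Set (E n)).Nontrivial)
    (h0 : ∀ v : E n, ⟪(e : E n), v⟫_ℝ = 0 → width L v = 0) : IsLineSegment (L : Set (E n)) := by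
  have hline : ∀ y ∈ (L : Set (E n)), ∀ z ∈ (L : Set (E n)),
      y - z = ⟪(e : E n), y - z⟫_ℝ • (e : E n) := by
    intro y hy z hz
    set p := y - z - ⟪(e : E n), y - z⟫_ℝ • (e : E n) with hp
    have hpe : ⟪(e : E n), p⟫_ℝ = 0 := by
      rw [hp, inner_sub_right, inner_smul_right, inner_self_sphere, mul_one, sub_self]
    have h := inner_eq_of_width_eq_zero (h0 p hpe) hy hz
    have h2 : ⟪p, p⟫_ℝ = 0 := by
      conv_lhs => rw [hp]
      rw [inner_sub_left, h, inner_smul_left, hpe]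
      simp
    exact sub_eq_zero.1 (inner_self_eq_zero.1 h2)
  obtain ⟨x, hx, hmin⟩ := L.isCompact.exists_isMinOn L.nonempty
    (f := fun y : E n => ⟪(e : E n), y⟫_ℝ) (by fun_prop)
  obtain ⟨y, hy, hmax⟩ := L.isCompact.exists_isMaxOn L.nonempty
    (f := fun y : E n => ⟪(e : E n), y⟫_ℝ) (by fun_prop)
  have hmin' : ∀ z ∈ (L : Set (E n)), ⟪(e : E n), x⟫_ℝ ≤ ⟪(e : E n), z⟫_ℝ := fun z hz => hmin hz
  have hmax' : ∀ z ∈ (L : Set (E n)), ⟪(e : E n), z⟫_ℝ ≤ ⟪(e : E n), y⟫_ℝ := fun z hz => hmax hz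
  have hlt : ⟪(e : E n), x⟫_ℝ < ⟪(e : E n), y⟫_ℝ := by
    by_contra hcon
    obtain ⟨p, hp, q, hq, hpq⟩ := hpt
    have h1 : ⟪(e : E n), p - q⟫_ℝ = 0 := by
      rw [inner_sub_right]
      linarith [hmin' p hp, hmin' q hq, hmax' p hp, hmax' q hq, not_lt.1 hcon]
    have h2 := hline p hp q hq
    rw [h1, zero_smul] at h2
    exact hpq (sub_eq_zero.1 h2)
  refine ⟨x, y, fun h => hlt.ne (by rw [h]), Subset.antisymm (fun z hz => ?_)
    (L.convex.segment_subset hx hy)⟩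
  rw [segment_eq_image']
  have hd : 0 < ⟪(e : E n), y - x⟫_ℝ := by
    rw [inner_sub_right]
    linarith
  refine ⟨⟪(e : E n), z - x⟫_ℝ / ⟪(e : E n), y - x⟫_ℝ, ⟨?_, ?_⟩, ?_⟩
  · refine div_nonneg ?_ hd.le
    rw [inner_sub_right]
    linarith [hmin' z hz]
  · rw [div_le_one hd, inner_sub_right, inner_sub_right]
    linarith [hmax' z hz]
  · have h1 := hline z hz x hx
    have h2 := hline y hy x hx
    simp only
    rw [h2, inner_smul_right, inner_self_sphere, mul_one, smul_smul, div_mul_cancel₀ _ hd.ne', ← h1,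
      add_sub_cancel]

theorem supp_disk {c : E n} {ν : S n} {r : ℝ} (hr : 0 < r)
    (h : (L : Set (E n)) = {x : E n | ⟪x - c, (ν : E n)⟫_ℝ = 0 ∧ ‖x - c‖ ≤ r}) (x : E n) :
    supp L x = ⟪c, x⟫_ℝ + r * ‖x - ⟪(ν : E n), x⟫_ℝ • (ν : E n)‖ := by
  set p := x - ⟪(ν : E n), x⟫_ℝ • (ν : E n) with hp
  have hpν : ⟪p, (ν : E n)⟫_ℝ = 0 := by
    rw [hp, inner_sub_left, inner_smul_left, inner_self_sphere, real_inner_comm]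
    simp
  have hpx : ⟪p, x⟫_ℝ = ‖p‖ ^ 2 := by
    have : x = p + ⟪(ν : E n), x⟫_ℝ • (ν : E n) := by rw [hp, sub_add_cancel]
    conv_lhs => rw [this]
    rw [inner_add_right, inner_smul_right, hpν, mul_zero, add_zero, real_inner_self_eq_norm_sq]
  refine le_antisymm (supp_le fun y hy => ?_) ?_
  · rw [h] at hy
    obtain ⟨hyν, hyr⟩ := hy
    have e1 : ⟪y - c, p⟫_ℝ = ⟪y, x⟫_ℝ - ⟪c, x⟫_ℝ := by
      rw [hp, inner_sub_right, inner_smul_right, hyν, mul_zero, sub_zero, inner_sub_left]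
    have e2 := real_inner_le_norm (y - c) p
    have e3 := mul_le_mul_of_nonneg_right hyr (norm_nonneg p)
    linarith
  -- The maximizer is the boundary point in direction `p`; for `p = 0` the convention `0⁻¹ = 0`
  -- makes it the centre.
  · have hmem : c + (r * ‖p‖⁻¹) • p ∈ (L : Set (E n)) := by
      rw [h, mem_ofPred_eq, add_sub_cancel_left, inner_smul_left, hpν, mul_zero, norm_smul,
        norm_mul, norm_inv, norm_norm, Real.norm_eq_abs, abs_of_pos hr, mul_assoc]
      refine ⟨rfl, mul_le_of_le_one_right hr.le ?_⟩
      exact inv_mul_le_one_of_le₀ le_rfl (norm_nonneg p)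
    have h1 := inner_le_supp L hmem x
    rw [inner_add_left, inner_smul_left, hpx] at h1
    refine le_of_eq_of_le ?_ h1
    rcases eq_or_ne ‖p‖ 0 with h0 | h0
    · simp [h0]
    · simp only [conj_trivial]
      field_simp

theorem width_disk {c : E n} {ν : S n} {r : ℝ} (hr : 0 < r)
    (h : (L : Set (E n)) = {x : E n | ⟪x - c, (ν : E n)⟫_ℝ = 0 ∧ ‖x - c‖ ≤ r}) (x : E n) :
    width L x = 2 * r * ‖x - ⟪(ν : E n), x⟫_ℝ • (ν : E n)‖ := by
  rw [width, supp_disk hr h, supp_disk hr h, inner_neg_right, inner_neg_right, neg_smul,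
    ← neg_sub', norm_neg]
  ring

/-- The normal `ν` must be `±e`. The width vanishes only on `ℝν`; were `ν` orthogonal to `e`,
rotation would make it vanish on all of `e`'s orthogonal complement. So `ν` has an axial part,
whence `W(e) = 0` and `e` lies in `ℝν`. -/
theorem width_of_isDisk (hn : 3 ≤ n) (hL : IsBodyOfRevolution e L)
    (hD : IsDisk (L : Set (E n))) :
    ∃ C : ℝ, ∀ x : E n, width L x = C * ‖x - ⟪(e : E n), x⟫_ℝ • (e : E n)‖ := by
  obtain ⟨c, ν, r, hr, h⟩ := hD
  have hW := width_disk hr h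
  have hzero : ∀ x : E n, width L x = 0 → x = ⟪(ν : E n), x⟫_ℝ • (ν : E n) := by
    intro x hx
    rw [hW x] at hx
    have h2 : ‖x - ⟪(ν : E n), x⟫_ℝ • (ν : E n)‖ = 0 := by
      rcases mul_eq_zero.1 hx with h3 | h3
      · linarith
      · exact h3
    exact sub_eq_zero.1 (norm_eq_zero.1 h2)
  have hν0 : width L (ν : E n) = 0 := by
    rw [hW, inner_self_sphere, one_smul, sub_self, norm_zero, mul_zero]
  have heν : ⟪(e : E n), (ν : E n)⟫_ℝ ≠ 0 := by
    intro h0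
    obtain ⟨w, hw, hwe, hwν⟩ := exists_unit_orthogonal hn (e : E n) (ν : E n)
    have h1 := hzero w (width_eq_zero_of_orthogonal hn hL (norm_coe_sphere ν) h0 hν0 hwe)
    rw [hwν, zero_smul] at h1
    rw [h1, norm_zero] at hw
    exact zero_ne_one hw
  have he := hzero _ (width_axis_eq_zero hn hL hν0 heν)
  refine ⟨2 * r, fun x => ?_⟩
  rw [hW x]
  set a := ⟪(ν : E n), (e : E n)⟫_ℝ with ha
  have ha2 : a * a = 1 := by
    have h1 := inner_self_sphere e
    nth_rewrite 1 [he] at h1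
    rwa [inner_smul_left, ← ha, conj_trivial] at h1
  rw [he, inner_smul_left, smul_smul, conj_trivial]
  congr 4
  linear_combination (-⟪(ν : E n), x⟫_ℝ) * ha2

theorem width_segment {x y : E n} (h : (L : Set (E n)) = segment ℝ x y) (u : E n) :
    width L u = |⟪y - x, u⟫_ℝ| := by
  have hx : x ∈ (L : Set (E n)) := h ▸ left_mem_segment ℝ x y
  have hy : y ∈ (L : Set (E n)) := h ▸ right_mem_segment ℝ x y
  have hle : ∀ v : E n, supp L v ≤ max ⟪x, v⟫_ℝ ⟪y, v⟫_ℝ := by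
    intro v
    refine supp_le fun z hz => ?_
    rw [h] at hz
    obtain ⟨a, b, ha, hb, hab, rfl⟩ := hz
    rw [inner_add_left, inner_smul_left, inner_smul_left, conj_trivial, conj_trivial]
    have h1 := mul_le_mul_of_nonneg_left (le_max_left ⟪x, v⟫_ℝ ⟪y, v⟫_ℝ) ha
    have h2 := mul_le_mul_of_nonneg_left (le_max_right ⟪x, v⟫_ℝ ⟪y, v⟫_ℝ) hb
    calc _ ≤ (a + b) * max ⟪x, v⟫_ℝ ⟪y, v⟫_ℝ := by linarith
      _ = _ := by rw [hab, one_mul]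
  refine le_antisymm ?_ (abs_inner_sub_le_width L hy hx u)
  have h1 := hle u
  have h2 := hle (-u)
  rw [inner_neg_right, inner_neg_right] at h2
  rw [width, inner_sub_left]
  rcases le_total ⟪x, u⟫_ℝ ⟪y, u⟫_ℝ with hc | hc
  · rw [max_eq_right hc] at h1
    rw [max_eq_left (neg_le_neg hc)] at h2
    rw [abs_of_nonneg (sub_nonneg.2 hc)]
    linarith
  · rw [max_eq_left hc] at h1
    rw [max_eq_right (neg_le_neg hc)] at h2
    rw [abs_of_nonpos (sub_nonpos.2 hc)]
    linarith

/-- The direction `v` must be parallel to `e`. If `v` were orthogonal to `e`, a common normal of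
both would have zero width, hence so would `v`. If `v` were oblique, some direction orthogonal to
`v` but not to `e` would force `W(e) = 0`, that is, `⟪e, v⟫ = 0`. -/
theorem width_of_isLineSegment (hn : 3 ≤ n) (hL : IsBodyOfRevolution e L)
    (hS : IsLineSegment (L : Set (E n))) :
    ∃ C : ℝ, ∀ u : E n, width L u = C * |⟪(e : E n), u⟫_ℝ| := by
  obtain ⟨x, y, hxy, h⟩ := hS
  have hW := width_segment h
  set v := y - x with hv
  have hv0 : v ≠ 0 := sub_ne_zero.2 hxy.symm
  set a := ⟪(e : E n), v⟫_ℝ with ha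
  have ha0 : a ≠ 0 := by
    intro h0
    obtain ⟨w, hw, hwe, hwv⟩ := exists_unit_orthogonal hn (e : E n) v
    have hw0 : width L w = 0 := by rw [hW, hwv, abs_zero]
    have h1 := width_eq_zero_of_orthogonal hn hL hw hwe hw0 h0
    rw [hW, abs_eq_zero, inner_self_eq_zero] at h1
    exact hv0 h1
  set w := v - a • (e : E n) with hw
  have hwe : ⟪(e : E n), w⟫_ℝ = 0 := by
    rw [hw, inner_sub_right, inner_smul_right, inner_self_sphere, ← ha, mul_one, sub_self]
  have hvw : v = a • (e : E n) + w := by rw [hw, add_sub_cancel]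
  have hw0 : w = 0 := by
    by_contra hne
    have hwn : ‖w‖ ^ 2 ≠ 0 := by positivity
    -- This combination is orthogonal to `v = a e + w`, and its axial component `‖w‖²` is nonzero.
    have hz : width L (‖w‖ ^ 2 • (e : E n) - a • w) = 0 := by
      rw [hW, hvw, abs_eq_zero, inner_add_left, inner_sub_right, inner_sub_right]
      simp only [inner_smul_left, inner_smul_right, conj_trivial, inner_self_sphere, hwe,
        real_inner_self_eq_norm_sq w, real_inner_comm (e : E n) w]
      ring
    have h1 := width_axis_eq_zero hn hL hz (by
      rw [inner_sub_right, inner_smul_right, inner_smul_right, hwe, inner_self_sphere]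
      simpa using hne)
    rw [hW, abs_eq_zero, real_inner_comm] at h1
    exact ha0 h1
  refine ⟨|a|, fun u => ?_⟩
  rw [hW, hvw, hw0, add_zero, inner_smul_left, abs_mul, conj_trivial]

end Shapes

/-! ### The sign argument and the equality cases -/

section Integrals

variable {n : ℕ} {e : S n} {L : ConvexBody (E n)}

theorem integrable_sphere {f : S n → ℝ} (hf : Continuous f) : Integrable f (sphereMeasure n) :=
  hf.integrable_of_hasCompactSupport (HasCompactSupport.of_compactSpace _)

theorem integral_sphere_pos {f : S n → ℝ} (hf : Continuous f) (h0 : ∀ u, 0 ≤ f u) {u : S n}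
    (hu : f u ≠ 0) : 0 < ∫ u, f u ∂(sphereMeasure n) :=
  hf.integral_pos_of_hasCompactSupport_nonneg_nonzero (HasCompactSupport.of_compactSpace _) h0 hu

theorem width_coe_sphere (u : S n) : width L (u : E n) = supportFn L u + supportFn L (-u) := rfl

theorem continuous_width_sphere : Continuous fun u : S n => width L (u : E n) := by
  have h : Continuous fun u : S n => supportFn L u + supportFn L (-u) :=
    (supportFn L).continuous.add ((supportFn L).continuous.comp continuous_neg)
  exact h

/-- Against even functions the width integrates to twice the support function. -/
theorem integral_width_mul (hn : 0 < n) {g : S n → ℝ} (hg : Continuous g)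
    (heven : ∀ u, g (-u) = g u) :
    ∫ u : S n, width L (u : E n) * g u ∂(sphereMeasure n) =
      2 * ∫ u : S n, supportFn L u * g u ∂(sphereMeasure n) := by
  have h1 : ∀ u : S n, width L (u : E n) * g u =
      supportFn L u * g u + supportFn L (-u) * g (-u) := by
    intro u
    rw [width_coe_sphere, heven, add_mul]
  have hc : Continuous fun u : S n => supportFn L u * g u := (supportFn L).continuous.mul hg
  have hcn : Continuous fun u : S n => supportFn L (-u) * g (-u) := hc.comp continuous_neg
  simp only [h1]
  rw [integral_add (integrable_sphere hc) (integrable_sphere hcn),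
    integral_comp_neg_sphere hn fun u => supportFn L u * g u, two_mul]

/-- The support function may change sign, but the width is nonnegative and is positive in the
direction joining two distinct points of `L`. -/
theorem integral_supportFn_pos (hn : 0 < n) (hpt : (L : Set (E n)).Nontrivial) :
    0 < ∫ u : S n, supportFn L u ∂(sphereMeasure n) := by
  obtain ⟨p, hp, q, hq, hpq⟩ := hpt
  have hd : p - q ≠ 0 := sub_ne_zero.2 hpq
  have hdn : ‖p - q‖ ≠ 0 := norm_ne_zero_iff.2 hd
  let u : S n := ⟨‖p - q‖⁻¹ • (p - q), by simp [norm_smul, hd]⟩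
  have hu : width L (u : E n) ≠ 0 := by
    intro h0
    have h1 := inner_eq_of_width_eq_zero h0 hp hq
    change ⟪p - q, ‖p - q‖⁻¹ • (p - q)⟫_ℝ = 0 at h1
    rw [inner_smul_right, real_inner_self_eq_norm_sq] at h1
    have h2 : ‖p - q‖⁻¹ * ‖p - q‖ ^ 2 ≠ 0 := by positivity
    exact h2 h1
  have hpos := integral_sphere_pos continuous_width_sphere (fun u => width_nonneg L (u : E n)) hu
  have h := integral_width_mul (L := L) hn (g := fun _ => 1) continuous_const fun _ => rfl
  simp only [mul_one] at h
  linarith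

/-- The principle behind both inequalities: if `k` is orthogonal to the even weight `g` and
`(W - C k) g ≥ 0`, then `∫ h_L g ≥ 0`, with equality only if `(W - C k) g = 0` everywhere. -/
theorem integral_supportFn_mul_nonneg (hn : 0 < n) {g k : S n → ℝ} (hg : Continuous g)
    (hk : Continuous k) (heven : ∀ u, g (-u) = g u)
    (hkg : ∫ u, k u * g u ∂(sphereMeasure n) = 0) {C : ℝ}
    (hC : ∀ u : S n, 0 ≤ (width L (u : E n) - C * k u) * g u) :
    0 ≤ ∫ u, supportFn L u * g u ∂(sphereMeasure n) ∧
    (∫ u, supportFn L u * g u ∂(sphereMeasure n) = 0 ↔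
      ∀ u : S n, (width L (u : E n) - C * k u) * g u = 0) := by
  have hcont : Continuous fun u : S n => (width L (u : E n) - C * k u) * g u :=
    (continuous_width_sphere.sub (continuous_const.mul hk)).mul hg
  have h1 : ∫ u : S n, (width L (u : E n) - C * k u) * g u ∂(sphereMeasure n) =
      2 * ∫ u, supportFn L u * g u ∂(sphereMeasure n) := by
    have hW : Continuous fun u : S n => width L (u : E n) * g u := continuous_width_sphere.mul hg
    have hK : Continuous fun u : S n => C * (k u * g u) := continuous_const.mul (hk.mul hg)
    simp only [sub_mul, mul_assoc]
    rw [integral_sub (integrable_sphere hW) (integrable_sphere hK), integral_const_mul, hkg,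
      mul_zero, sub_zero, integral_width_mul hn hg heven]
  have h2 : 0 ≤ ∫ u : S n, (width L (u : E n) - C * k u) * g u ∂(sphereMeasure n) :=
    integral_nonneg hC
  refine ⟨by linarith, fun h u => ?_, fun h => ?_⟩
  · by_contra hne
    have := integral_sphere_pos hcont hC hne
    linarith
  · simp only [h, integral_zero] at h1
    linarith

theorem integral_supportFn_disk_weight (hn : 3 ≤ n) (hL : IsBodyOfRevolution e L)
    (hpt : (L : Set (E n)).Nontrivial) :
    0 ≤ ∫ u : S n, supportFn L u * ((n + 1) * ⟪(e : E n), (u : E n)⟫_ℝ ^ 2 - 1)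
      ∂(sphereMeasure n) ∧
    (∫ u : S n, supportFn L u * ((n + 1) * ⟪(e : E n), (u : E n)⟫_ℝ ^ 2 - 1)
      ∂(sphereMeasure n) = 0 ↔ IsDisk (L : Set (E n))) := by
  have hn0 : 0 < n := by omega
  have key := fun C => integral_supportFn_mul_nonneg (L := L) hn0
    (g := fun u : S n => (n + 1) * ⟪(e : E n), (u : E n)⟫_ℝ ^ 2 - 1)
    (k := fun u : S n => ‖(u : E n) - ⟪(e : E n), (u : E n)⟫_ℝ • (e : E n)‖)
    (by fun_prop) (by fun_prop) (fun u => by simp) (integral_sphere_orthogonal_norm hn0 e) (C := C)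
  obtain ⟨C, hC⟩ := exists_disk_comparison hn hL
  refine ⟨(key C hC).1, fun h => ?_, fun h => ?_⟩
  -- At the pole the disk profile vanishes and the weight is `n`, so the width along the axis must
  -- be zero.
  · have he := ((key C hC).2.1 h) e
    simp only [inner_self_sphere, one_smul, sub_self, norm_zero, mul_zero, sub_zero, one_pow,
      mul_one, add_sub_cancel_right] at he
    refine isDisk_of_width_axis_eq_zero hn hL hpt ((mul_eq_zero.1 he).resolve_right ?_)
    exact_mod_cast hn0.ne'
  -- This constant need not be compared with `C`: the sign principle holds for any constant making
  -- the product nonnegative.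
  · obtain ⟨C', hC'⟩ := width_of_isDisk hn hL h
    have hzero : ∀ u : S n, (width L (u : E n) -
        C' * ‖(u : E n) - ⟪(e : E n), (u : E n)⟫_ℝ • (e : E n)‖) *
        ((n + 1) * ⟪(e : E n), (u : E n)⟫_ℝ ^ 2 - 1) = 0 := fun u => by
      rw [hC', sub_self, zero_mul]
    exact (key C' fun u => (hzero u).ge).2.2 hzero

theorem integral_supportFn_segment_weight (hn : 3 ≤ n) (hL : IsBodyOfRevolution e L)
    (hpt : (L : Set (E n)).Nontrivial) :
    0 ≤ ∫ u : S n, supportFn L u * (2 - (n + 1) * ⟪(e : E n), (u : E n)⟫_ℝ ^ 2)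
      ∂(sphereMeasure n) ∧
    (∫ u : S n, supportFn L u * (2 - (n + 1) * ⟪(e : E n), (u : E n)⟫_ℝ ^ 2)
      ∂(sphereMeasure n) = 0 ↔ IsLineSegment (L : Set (E n))) := by
  have hn0 : 0 < n := by omega
  have key := fun C => integral_supportFn_mul_nonneg (L := L) hn0
    (g := fun u : S n => 2 - (n + 1) * ⟪(e : E n), (u : E n)⟫_ℝ ^ 2)
    (k := fun u : S n => |⟪(e : E n), (u : E n)⟫_ℝ|)
    (by fun_prop) (by fun_prop) (fun u => by simp) (integral_sphere_abs_inner hn0 e) (C := C)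
  obtain ⟨C, hC⟩ := exists_segment_comparison hn hL
  refine ⟨(key C hC).1, fun h => ?_, fun h => ?_⟩
  · obtain ⟨w, hw, hwe, -⟩ := exists_unit_orthogonal hn (e : E n) 0
    -- Orthogonally to the axis the segment profile vanishes and the weight is `2`.
    have h0 := ((key C hC).2.1 h) ⟨w, by simpa using hw⟩
    simp only [hwe, abs_zero, mul_zero, sub_zero, ne_eq, OfNat.ofNat_ne_zero, not_false_eq_true,
      zero_pow, mul_eq_zero, or_false] at h0
    exact isLineSegment_of_width_orthogonal_eq_zero hpt fun v hv =>
      width_eq_zero_of_orthogonal hn hL hw hwe h0 hv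
  · obtain ⟨C', hC'⟩ := width_of_isLineSegment hn hL h
    have hzero : ∀ u : S n, (width L (u : E n) - C' * |⟪(e : E n), (u : E n)⟫_ℝ|) *
        (2 - (n + 1) * ⟪(e : E n), (u : E n)⟫_ℝ ^ 2) = 0 := fun u => by
      rw [hC', sub_self, zero_mul]
    exact (key C' fun u => (hzero u).ge).2.2 hzero

theorem integral_mul_quadratic (h : C(S n, ℝ)) (a b : ℝ) :
    ∫ u : S n, h u * (a * ⟪(e : E n), (u : E n)⟫_ℝ ^ 2 + b) ∂(sphereMeasure n) =
      a * ∫ u : S n, h u * ⟪(e : E n), (u : E n)⟫_ℝ ^ 2 ∂(sphereMeasure n) +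
        b * ∫ u : S n, h u ∂(sphereMeasure n) := by
  have h2 : Integrable (fun u : S n => h u * ⟪(e : E n), (u : E n)⟫_ℝ ^ 2) (sphereMeasure n) :=
    integrable_sphere (by fun_prop)
  rw [← integral_const_mul, ← integral_const_mul,
    ← integral_add (h2.const_mul a) ((integrable_sphere h.continuous).const_mul b)]
  congr 1
  ext u
  ring

end Integrals

end ConvexRevolution
end

/-! ### The two inequalities and their equality cases -/

open ConvexRevolution in
theorem mainTheorem9 (n : ℕ) [NeZero n] (hn : 3 ≤ n) (e : S n) (L : ConvexBody (E n))
    (hL : IsBodyOfRevolution e L) (hpt : (L : Set (E n)).Nontrivial) :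
    0 < multiplier e 0 (boxDual (toDual (supportFn L))) ∧
    -(1 / ((n : ℝ) - 1)) ≤ multiplier e 2 (boxDual (toDual (supportFn L))) /
      multiplier e 0 (boxDual (toDual (supportFn L))) ∧
    multiplier e 2 (boxDual (toDual (supportFn L))) /
      multiplier e 0 (boxDual (toDual (supportFn L))) ≤ 1 / ((n : ℝ) - 1) ^ 2 ∧
    (multiplier e 2 (boxDual (toDual (supportFn L))) /
        multiplier e 0 (boxDual (toDual (supportFn L))) = -(1 / ((n : ℝ) - 1)) ↔
      IsLineSegment (L : Set (E n))) ∧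
    (multiplier e 2 (boxDual (toDual (supportFn L))) /
        multiplier e 0 (boxDual (toDual (supportFn L))) = 1 / ((n : ℝ) - 1) ^ 2 ↔
      IsDisk (L : Set (E n))) := by
  have hn3 : (3 : ℝ) ≤ n := by exact_mod_cast hn
  have hn1 : (0 : ℝ) < (n : ℝ) - 1 := by linarith
  have hA := integral_supportFn_pos (L := L) (by omega) hpt
  obtain ⟨hD, hDiff⟩ := integral_supportFn_disk_weight hn hL hpt
  obtain ⟨hS, hSiff⟩ := integral_supportFn_segment_weight hn hL hpt
  rw [multiplier_zero, multiplier_two hn, ← hDiff, ← hSiff]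
  have e0 := integral_mul_quadratic (e := e) (supportFn L) n (-1)
  have e1 := integral_mul_quadratic (e := e) (supportFn L) (n + 1) (-1)
  have e2 := integral_mul_quadratic (e := e) (supportFn L) (-(n + 1)) 2
  have e2' : ∀ u : S n, -((n : ℝ) + 1) * ⟪(e : E n), (u : E n)⟫_ℝ ^ 2 + 2 =
      2 - (n + 1) * ⟪(e : E n), (u : E n)⟫_ℝ ^ 2 := fun u => by ring
  simp only [← sub_eq_add_neg] at e0 e1
  simp only [e2'] at e2
  rw [e1] at hD ⊢
  rw [e2] at hS ⊢
  rw [e0]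
  set A := ∫ u : S n, supportFn L u ∂(sphereMeasure n)
  set I := ∫ u : S n, supportFn L u * ⟪(e : E n), (u : E n)⟫_ℝ ^ 2 ∂(sphereMeasure n)
  have hc : 0 < n / (((n : ℝ) - 1) ^ 2 * A) := by positivity
  -- The gap between the quotient and each bound is a positive multiple of the corresponding
  -- weighted integral, which settles the inequality and its equality case together.
  have hDeq : -((n + 1) / ((n : ℝ) - 1) ^ 2) * (n * I + -1 * A) / A =
      1 / ((n : ℝ) - 1) ^ 2 - n / (((n : ℝ) - 1) ^ 2 * A) * ((n + 1) * I + -1 * A) := by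
    field_simp
    ring
  have hSeq : -((n + 1) / ((n : ℝ) - 1) ^ 2) * (n * I + -1 * A) / A =
      -(1 / ((n : ℝ) - 1)) + n / (((n : ℝ) - 1) ^ 2 * A) * (-(n + 1) * I + 2 * A) := by
    field_simp
    ring
  refine ⟨hA, ?_, ?_, ?_, ?_⟩
  · rw [hSeq]
    linarith [mul_nonneg hc.le hS]
  · rw [hDeq]
    linarith [mul_nonneg hc.le hD]
  · rw [hSeq, add_eq_left, mul_eq_zero, or_iff_right hc.ne']
  · rw [hDeq, sub_eq_self, mul_eq_zero, or_iff_right hc.ne']
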